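/- **Setting.** Consider a tabular episodic MDP with finite state space of size $S\ge1$, finite action space of size $A\ge1$, $H\ge1$ steps per episode, time-dependent transition kernels $P_h(\cdot\mid s,a)$, $h\in[H]$, and a fixed starting state $s_1$. The reachability of $s$ at step $h$ is $\delta_h(s)=\max_\pi \mathbb P^\pi(s_h=s)$, the maximum over all (stochastic, non-stationary) policies. For $p\in(0,1)$, a number of episodes $K\ge 1$ and a parameter $N$, let $$\iota_K=\log(SAHK/p),\qquad b_t=c\sqrt{H^3(\log N+\iota_K)/t},\qquad \alpha_t=\frac{H+1}{H+t}.$$ **Exploration phase of UCBZero.** Start with $\overline Q_h(s,a)=H$ and counts $N_h(s,a)=0$. In each of $K$ episodes, starting at $s_1$, at steps $h=1,\dots,H$: play $a_h\in\arg\max_a\overline Q_h(s_h,a)$ (ties broken by any, possibly randomized and history-dependent, rule), observe $s_{h+1}\sim P_h(\cdot\mid s_h,a_h)$, increase $N_h(s_h,a_h)$ by one, put $t=N_h(s_h,a_h)$, and set $$\overline Q_h(s_h,a_h)\leftarrow(1-\alpha_t)\overline Q_h(s_h,a_h)+\alpha_t\big[\overline V_{h+1}(s_{h+1})+2b_t\big],$$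 where $\overline V_{h}(s)=\min(H,\max_a\overline Q_{h}(s,a))$ for $h\le H$ and $\overline V_{H+1}=0$. **Optimistic values for a reward.** For a reward function $r_h(s,a,s')$, process the collected transitions in the same order by the same update, from the same initialization, with $r_h(s_h,a_h,s_{h+1})+V_{h+1}(s_{h+1})+b_t$ in place of $\overline V_{h+1}(s_{h+1})+2b_t$. Let $V_1^k(s_1)=\min(H,\max_aQ_1(s_1,a))$ be computed from the table at the beginning of episode $k$, and $\tilde V[r]=\frac1K\sum_{k=1}^KV_1^k(s_1)$. **Estimates.** For $(h,s,a,s')$ let $\hat P_h(s'\mid s,a)=\tilde V[R^{(1)}]/\tilde V[R^{(2)}]$, where $R^{(1)}$ is the indicator of taking action $a$ in state $s$ at step $h$ and moving to $s'$, and $R^{(2)}$ is the indicator of being in state $s$ at step $h$. **Theorem 3.** There are absolute constants $c,C>0$ such that the following holds for all such MDPs, all $p\in(0,1)$, all $\epsilon>0$, and all integers $1\le N\le 2HS^2A$ (the number of indicator rewards used). If UCBZero is run with $K$ exploration episodes, where $$K\ \ge\ 1\qquad\text{and}\qquad K\ \ge\ C\,\frac{H^5SA\,\iota_K}{\epsilon^2},$$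 then with probability at least $1-p$, for all $(h,s,a,s')$ with $\delta_h(s)>0$, $$\big|\hat P_h(s'\mid s,a)-P_h(s'\mid s,a)\big|\le\frac{\epsilon}{\delta_h(s)}.$$ Moreover such numbers of episodes exist within the claimed order: there is $K_0\ge1$ with $K_0\le 1+C\,H^5SA\,\iota_{K_0}/\epsilon^2$ such that every $K\ge K_0$ satisfies the condition on $K$. -/

import Mathlib

noncomputable section

namespace UCBZero

/-- The reward-free part of a tabular episodic MDP with `H` steps per episode: the kernels
`P h s a` (time-dependent law of the next state) and a fixed starting state.
Steps are indexed from `0`: the element `h` of `Fin H` is the `(h+1)`-st step of an episode. -/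
structure EpisodicMDP (S A : Type*) (H : ℕ) where
  P : Fin H → S → A → PMF S
  start : S

/-- A (stochastic, non-stationary) policy. -/
abbrev Policy (S A : Type*) (H : ℕ) := Fin H → S → PMF A

/-- The law of the state reached after the first `n` steps when following the policy `π` from the
starting state (constant for `n ≥ H`). -/
def stateLaw {S A : Type*} {H : ℕ} (M : EpisodicMDP S A H) (π : Policy S A H) : ℕ → PMF S
  | 0 => PMF.pure M.start
  | n + 1 =>
    if hn : n < H then
      (stateLaw M π n).bind fun s => (π ⟨n, hn⟩ s).bind fun a => M.P ⟨n, hn⟩ s a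
    else stateLaw M π n

/-- Reachability of `s` at step `h`: the maximal probability, over all policies, of being in
state `s` at step `h`. -/
def reachability {S A : Type*} {H : ℕ} (M : EpisodicMDP S A H) (h : Fin H) (s : S) : ℝ :=
  (⨆ π : Policy S A H, stateLaw M π h s).toReal

/-- One observed transition: step, state, action, next state. -/
structure Transition (S A : Type*) (H : ℕ) where
  step : Fin H
  state : S
  action : A
  next : S

/-- The tables that optimistic Q-learning maintains: action values and visit counts. -/
structure Tables (S A : Type*) (H : ℕ) where
  Q : Fin H → S → A → ℝ
  count : Fin H → S → A → ℕ

/-- Initial tables: all action values are `H`, all counts are `0`. -/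
def Tables.init (S A : Type*) (H : ℕ) : Tables S A H where
  Q := fun _ _ _ => H
  count := fun _ _ _ => 0

/-- The truncated greedy value `min(H, max_a Q_h(s,a))`. -/
def Tables.value {S A : Type*} {H : ℕ} [Fintype A] [Nonempty A]
    (T : Tables S A H) (h : Fin H) (s : S) : ℝ :=
  min (H : ℝ) (Finset.univ.sup' Finset.univ_nonempty (T.Q h s))

/-- The value at the step after `h`; it is `0` after the last step. -/
def Tables.nextValue {S A : Type*} {H : ℕ} [Fintype A] [Nonempty A]
    (T : Tables S A H) (h : Fin H) (s : S) : ℝ :=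
  if hn : (h : ℕ) + 1 < H then T.value ⟨h + 1, hn⟩ s else 0

/-- The learning rate `α_t = (H+1)/(H+t)`. -/
def learningRate (H t : ℕ) : ℝ := ((H : ℝ) + 1) / ((H : ℝ) + t)

open Classical in
/-- The optimistic Q-learning update at one transition `x`, with reward function `r` and bonus
`b t` at the `t`-th visit:
`Q_h(s,a) ← (1 - α_t) Q_h(s,a) + α_t (r_h(s,a,s') + V_{h+1}(s') + b_t)`. -/
def Tables.update {S A : Type*} {H : ℕ} [Fintype A] [Nonempty A]
    (b : ℕ → ℝ) (r : Fin H → S → A → S → ℝ) (T : Tables S A H) (x : Transition S A H) :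
    Tables S A H where
  Q := fun h s a =>
    if h = x.step ∧ s = x.state ∧ a = x.action then
      (1 - learningRate H (T.count h s a + 1)) * T.Q h s a
        + learningRate H (T.count h s a + 1)
          * (r h s a x.next + T.nextValue h x.next + b (T.count h s a + 1))
    else T.Q h s a
  count := fun h s a =>
    if h = x.step ∧ s = x.state ∧ a = x.action then T.count h s a + 1 else T.count h s a

/-- The tables after processing a list of transitions in chronological order. -/
def learn {S A : Type*} {H : ℕ} [Fintype A] [Nonempty A]
    (b : ℕ → ℝ) (r : Fin H → S → A → S → ℝ) (L : List (Transition S A H)) : Tables S A H :=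
  L.foldl (Tables.update b r) (Tables.init S A H)

/-- The log factor `ι = log(S A H K / p)`. -/
def logFactor (nS nA H K : ℕ) (p : ℝ) : ℝ :=
  Real.log ((nS : ℝ) * nA * H * K / p)

/-- The bonus `b_t = c √(H³ (log N + ι) / t)`. -/
def bonus (c : ℝ) (nS nA H K N : ℕ) (p : ℝ) (t : ℕ) : ℝ :=
  c * Real.sqrt ((H : ℝ) ^ 3 * (Real.log N + logFactor nS nA H K p) / t)

/-- The pseudo-Q tables of the exploration phase after the transitions `L`: zero reward and
bonus `2 b_t`. -/
def pseudoTables {S A : Type*} {H : ℕ} [Fintype A] [Nonempty A]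
    (b : ℕ → ℝ) (L : List (Transition S A H)) : Tables S A H :=
  learn (fun t => 2 * b t) (fun _ _ _ _ => 0) L

/-- A (possibly randomized) rule for choosing the next action from all transitions observed so
far, the current step and the current state. -/
abbrev ActionRule (S A : Type*) (H : ℕ) := List (Transition S A H) → Fin H → S → PMF A

/-- The rule always plays a maximizer of the current pseudo-Q table; ties are broken
arbitrarily. -/
def IsGreedy {S A : Type*} {H : ℕ} [Fintype A] [Nonempty A]
    (b : ℕ → ℝ) (act : ActionRule S A H) : Prop :=
  ∀ (L : List (Transition S A H)) (h : Fin H) (s : S), ∀ a ∈ (act L h s).support,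
    ∀ a' : A, (pseudoTables b L).Q h s a' ≤ (pseudoTables b L).Q h s a

/-- The law of the first `n` steps of a new episode, after the transitions `L` of the earlier
episodes: the transitions of these steps and the current state. -/
def rollout {S A : Type*} {H : ℕ} (M : EpisodicMDP S A H) (act : ActionRule S A H)
    (L : List (Transition S A H)) : ℕ → PMF (List (Transition S A H) × S)
  | 0 => PMF.pure ([], M.start)
  | n + 1 =>
    if hn : n < H then
      (rollout M act L n).bind fun es =>
        (act (L ++ es.1) ⟨n, hn⟩ es.2).bind fun a =>
          (M.P ⟨n, hn⟩ es.2 a).map fun s' => (es.1 ++ [⟨⟨n, hn⟩, es.2, a, s'⟩], s')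
    else rollout M act L n

/-- The law of the data of `K` exploration episodes, as a chronological list of episodes. -/
def explore {S A : Type*} {H : ℕ} (M : EpisodicMDP S A H) (act : ActionRule S A H) :
    ℕ → PMF (List (List (Transition S A H)))
  | 0 => PMF.pure []
  | k + 1 =>
    (explore M act k).bind fun D => (rollout M act D.flatten H).map fun es => D ++ [es.1]

/-- The average over the episodes `k = 1, …, K` of `V_1^k(s₁)`, where `V^k` is the optimistic value
at the beginning of episode `k` of the policy-optimization phase, run on the data `D` with
rewards `r` and bonus `b`. -/
def averageValue {S A : Type*} {H : ℕ} [Fintype A] [Nonempty A] (b : ℕ → ℝ) (K : ℕ)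
    (D : List (List (Transition S A H))) (r : Fin H → S → A → S → ℝ) (hH : 0 < H) (s₁ : S) : ℝ :=
  (∑ k ∈ Finset.range K, (learn b r (D.take k).flatten).value ⟨0, hH⟩ s₁) / K

open Classical in
/-- The reward function that indicates the transition `(h, s, a, s')`. -/
def transitionReward {S A : Type*} {H : ℕ} (h : Fin H) (s : S) (a : A) (s' : S) :
    Fin H → S → A → S → ℝ :=
  fun g x y x' => if g = h ∧ x = s ∧ y = a ∧ x' = s' then 1 else 0

open Classical in
/-- The reward function that indicates the state `s` at step `h`. -/
def stateReward {S A : Type*} {H : ℕ} (h : Fin H) (s : S) : Fin H → S → A → S → ℝ :=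
  fun g x _ _ => if g = h ∧ x = s then 1 else 0

/-- The estimate of `P_h(s' | s, a)`: the ratio of the average optimistic values for the
two indicator reward functions. -/
def modelEstimate {S A : Type*} {H : ℕ} [Fintype A] [Nonempty A] (b : ℕ → ℝ) (K : ℕ)
    (D : List (List (Transition S A H))) (s₁ : S) (h : Fin H) (s : S) (a : A) (s' : S) : ℝ :=
  averageValue b K D (transitionReward h s a s') h.pos s₁ /
    averageValue b K D (stateReward h s) h.pos s₁

/-- The number of episodes `C H⁵ S A ι / ε²`. -/
def episodeBound (C : ℝ) (nS nA H K : ℕ) (p ε : ℝ) : ℝ :=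
  C * ((H : ℝ) ^ 5 * nS * nA * logFactor nS nA H K p / ε ^ 2)

end UCBZero

end

/-! The optimal value of the reward indicating `(h, s, a, s')` is `P_h(s' | s, a) * δ_h(s)`, and
that of the reward indicating `(h, s)` is `δ_h(s)`. If both averaged optimistic values overestimate
these by at most `ε`, elementary algebra puts their ratio within `ε / δ_h(s)` of `P_h(s' | s, a)`
(`abs_div_sub_le`). Three facts give the overestimation bound.

Concentration: the error of a table entry contains an average, with learning-rate weights, of
centred noise. An indicator reward is collected at most once per episode, so the noise lies in `[-1,
1]`. The squared weights sum to at most `2H/t`, and an exponential supermartingale gives a Gaussian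
tail for each fixed visit number (`toOuterMeasure_weightedSum_le`). A union bound over rewards,
entries, visit numbers and signs puts all noise below the bonuses (`toOuterMeasure_noise_le`).

Optimism: on that event the learned values lie above the optimal ones, and the excess is at most the
pseudo-value of exploration, whose bonus is twice as large (`IsOptimalValue.learn_bounds`). This
holds for every reward at once, although the data were collected without rewards.

Exploration: since actions are greedy for the pseudo-table, a potential of the tables pays for the
pseudo-values at the starting state. The argument is pathwise: the target uses the next state that
is actually visited, so no further martingale is needed. Cauchy-Schwarz over the visit counts bounds
the sum over `K` episodes by order `S A H² + β H √(S A K)` with `β` of order `√(H³ ι)`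
(`sum_valueAt_pseudoTables_le`), which is at most `ε K` for the required `K`. -/

noncomputable section

namespace UCBZero

open scoped ENNReal

/-! ### Expectations under discrete laws, and supermartingales along the exploration -/

section

/-- The expectation of a nonnegative function under a discrete law. -/
def expect {α : Type*} (q : PMF α) (f : α → ℝ≥0∞) : ℝ≥0∞ := ∑' x, q x * f x

theorem expect_pure {α : Type*} (a : α) (f : α → ℝ≥0∞) : expect (PMF.pure a) f = f a := by
  classical
  unfold expect
  rw [tsum_eq_single a]
  · simp
  · intro b hb; simp [hb]

theorem expect_bind {α β : Type*} (q : PMF α) (g : α → PMF β) (f : β → ℝ≥0∞) :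
    expect (q.bind g) f = expect q fun a => expect (g a) f := by
  unfold expect
  simp_rw [PMF.bind_apply, ← ENNReal.tsum_mul_right, ← ENNReal.tsum_mul_left]
  rw [ENNReal.tsum_comm]
  simp_rw [mul_assoc]

theorem expect_map {α β : Type*} (q : PMF α) (g : α → β) (f : β → ℝ≥0∞) :
    expect (q.map g) f = expect q fun a => f (g a) := by
  rw [PMF.map, expect_bind]
  simp [expect_pure]

theorem expect_const {α : Type*} (q : PMF α) (c : ℝ≥0∞) : expect q (fun _ => c) = c := by
  simp [expect, ENNReal.tsum_mul_right]

theorem expect_mono {α : Type*} (q : PMF α) {f g : α → ℝ≥0∞} (hfg : ∀ x, f x ≤ g x) :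
    expect q f ≤ expect q g :=
  ENNReal.tsum_le_tsum fun x => by gcongr; exact hfg x

theorem expect_le {α : Type*} (q : PMF α) {f : α → ℝ≥0∞} {c : ℝ≥0∞} (hf : ∀ x, f x ≤ c) :
    expect q f ≤ c :=
  (expect_mono q hf).trans (expect_const q c).le

/-- Markov's inequality. -/
theorem toOuterMeasure_lt_le {α : Type*} (q : PMF α) (f : α → ℝ≥0∞) {a : ℝ≥0∞}
    (ha : a ≠ 0) (hat : a ≠ ∞) :
    q.toOuterMeasure {x | a < f x} ≤ expect q f / a := by
  rw [ENNReal.le_div_iff_mul_le (Or.inl ha) (Or.inl hat), PMF.toOuterMeasure_apply,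
    ← ENNReal.tsum_mul_right]
  refine ENNReal.tsum_le_tsum fun x => ?_
  by_cases hx : a < f x
  · rw [Set.indicator_of_mem (by exact hx)]; gcongr
  · rw [Set.indicator_of_notMem (by exact hx)]; simp

variable {S A : Type*} {H : ℕ}

/-- `F` does not grow on average when one more transition is observed. -/
def IsSupermartingale (M : EpisodicMDP S A H) (F : List (Transition S A H) → ℝ≥0∞) : Prop :=
  ∀ (L : List (Transition S A H)) (h : Fin H) (s : S) (a : A),
    expect (M.P h s a) (fun s' => F (L ++ [⟨h, s, a, s'⟩])) ≤ F L

/-- The supermartingale inequality is required at every history, state and action, so it survives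
averaging over whatever action an adaptive rule picks. -/
theorem IsSupermartingale.expect_rollout_le {M : EpisodicMDP S A H}
    {F : List (Transition S A H) → ℝ≥0∞} (hF : IsSupermartingale M F) (act : ActionRule S A H)
    (L : List (Transition S A H)) (n : ℕ) :
    expect (rollout M act L n) (fun es => F (L ++ es.1)) ≤ F L := by
  induction n with
  | zero => simp [rollout, expect_pure]
  | succ n ih =>
    by_cases hn : n < H
    · simp only [rollout, hn, dif_pos, expect_bind, expect_map]
      refine (expect_mono _ fun es => ?_).trans ih
      refine expect_le _ fun a => ?_
      have := hF (L ++ es.1) ⟨n, hn⟩ es.2 a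
      simpa [List.append_assoc] using this
    · simpa only [rollout, hn, dif_neg, not_false_eq_true] using ih

theorem IsSupermartingale.expect_explore_le {M : EpisodicMDP S A H}
    {F : List (Transition S A H) → ℝ≥0∞} (hF : IsSupermartingale M F) (act : ActionRule S A H)
    (K : ℕ) :
    expect (explore M act K) (fun D => F D.flatten) ≤ F [] := by
  induction K with
  | zero => simp [explore, expect_pure]
  | succ k ih =>
    simp only [explore, expect_bind, expect_map]
    refine (expect_mono _ fun D => ?_).trans ih
    simpa using hF.expect_rollout_le act D.flatten H

end

section

/-! ### Weighted sums of the noise -/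

/-- The sum of `u (i + 1) * X x` over the entries `x` of a list, `i` being the position of `x`. -/
def weightedSum {S : Type*} (u : ℕ → ℝ) (X : S → ℝ) (l : List S) : ℝ :=
  (l.mapIdx fun i x => u (i + 1) * X x).sum

@[simp] theorem weightedSum_nil {S : Type*} (u : ℕ → ℝ) (X : S → ℝ) :
    weightedSum u X [] = 0 := rfl

theorem weightedSum_concat {S : Type*} (u : ℕ → ℝ) (X : S → ℝ) (l : List S) (x : S) :
    weightedSum u X (l ++ [x]) = weightedSum u X l + u (l.length + 1) * X x := by
  simp [weightedSum]

theorem weightedSum_congr {S : Type*} {u v : ℕ → ℝ} (X : S → ℝ) (l : List S)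
    (huv : ∀ i ≤ l.length, u i = v i) : weightedSum u X l = weightedSum v X l := by
  induction l using List.reverseRecOn with
  | nil => rfl
  | append_singleton l x ih =>
    rw [weightedSum_concat, weightedSum_concat, ih fun i hi => huv i (by simp; omega),
      huv (l.length + 1) (by simp)]

theorem weightedSum_mul_left {S : Type*} (c : ℝ) (u : ℕ → ℝ) (X : S → ℝ) (l : List S) :
    weightedSum (fun i => c * u i) X l = c * weightedSum u X l := by
  induction l using List.reverseRecOn with
  | nil => simp
  | append_singleton l x ih => rw [weightedSum_concat, weightedSum_concat, ih]; ring

theorem weightedSum_append_of_eq_zero {S : Type*} {u : ℕ → ℝ} (X : S → ℝ) (l l' : List S)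
    (hu : ∀ i, l.length < i → u i = 0) : weightedSum u X (l ++ l') = weightedSum u X l := by
  induction l' using List.reverseRecOn with
  | nil => simp
  | append_singleton l' x ih =>
    rw [← List.append_assoc, weightedSum_concat, ih, hu _ (by rw [List.length_append]; omega)]; simp

/-- The weight `α_t^i = α_i ∏_{j=i+1}^t (1 - α_j)` of the `i`-th target after `t` updates. -/
def weight (H : ℕ) : ℕ → ℕ → ℝ
  | 0, _ => 0
  | t + 1, i =>
    if i = t + 1 then learningRate H (t + 1) else (1 - learningRate H (t + 1)) * weight H t i

theorem weight_eq_zero {H t i : ℕ} (hi : t < i) : weight H t i = 0 := by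
  induction t with
  | zero => rfl
  | succ t ih => rw [weight, if_neg (by omega), ih (by omega), mul_zero]

theorem learningRate_one {H : ℕ} : learningRate H 1 = 1 := by
  unfold learningRate
  rw [Nat.cast_one, div_self]; positivity

theorem learningRate_pos {H t : ℕ} (ht : 1 ≤ t) : 0 < learningRate H t := by
  unfold learningRate
  have : (1 : ℝ) ≤ t := by exact_mod_cast ht
  positivity

theorem one_sub_learningRate (H t : ℕ) :
    1 - learningRate H (t + 1) = t / (H + t + 1) := by
  unfold learningRate
  push_cast
  have : (H : ℝ) + (t + 1) ≠ 0 := by positivity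
  field_simp
  ring

theorem learningRate_le_one {H t : ℕ} (ht : 1 ≤ t) : learningRate H t ≤ 1 := by
  obtain ⟨t, rfl⟩ := Nat.exists_eq_add_of_le' ht
  have := one_sub_learningRate H t
  have h2 : (0 : ℝ) ≤ t / (H + t + 1) := by positivity
  linarith

/-- Passing from `t` to `t + 1` scales the old sum by `(1 - α)²` and adds `α²`, so the bound follows
by induction. This sum is the variance proxy of the averaged noise. -/
theorem sum_weight_sq_le {H : ℕ} (hH : 0 < H) {t : ℕ} (ht : 1 ≤ t) :
    ∑ i ∈ Finset.range t, weight H t (i + 1) ^ 2 ≤ 2 * H / t := by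
  have hH' : (1 : ℝ) ≤ H := by exact_mod_cast hH
  induction t, ht using Nat.le_induction with
  | base => simp [weight, learningRate_one]; linarith
  | succ t ht ih =>
    have ht' : (1 : ℝ) ≤ t := by exact_mod_cast ht
    have hs : ∑ i ∈ Finset.range t, weight H (t + 1) (i + 1) ^ 2
        = (1 - learningRate H (t + 1)) ^ 2 * ∑ i ∈ Finset.range t, weight H t (i + 1) ^ 2 := by
      rw [Finset.mul_sum]
      refine Finset.sum_congr rfl fun i hi => ?_
      have := Finset.mem_range.1 hi
      rw [weight, if_neg (by omega)]; ring
    rw [Finset.sum_range_succ, hs]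
    have hw : weight H (t + 1) (t + 1) = learningRate H (t + 1) := by simp [weight]
    rw [hw]
    calc (1 - learningRate H (t + 1)) ^ 2 * ∑ i ∈ Finset.range t, weight H t (i + 1) ^ 2
          + learningRate H (t + 1) ^ 2
        ≤ (1 - learningRate H (t + 1)) ^ 2 * (2 * H / t) + learningRate H (t + 1) ^ 2 := by gcongr
      _ = (2 * (H : ℝ) * t + (H + 1) ^ 2) / (H + t + 1) ^ 2 := by
        rw [one_sub_learningRate]; unfold learningRate; push_cast
        rw [show (H : ℝ) + (t + 1) = H + t + 1 by ring]
        field_simp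
      _ ≤ 2 * H / ((t + 1 : ℕ) : ℝ) := by
        push_cast
        -- After clearing denominators the difference of the two sides is `(2H - 1)(H + 1)² + t (3H²
        -- - 1)`.
        rw [div_le_div_iff₀ (by positivity) (by positivity)]
        nlinarith [mul_nonneg (sub_nonneg.2 hH') (sub_nonneg.2 ht'),
          mul_le_mul hH' hH' zero_le_one (by linarith), mul_pos (by linarith : (0:ℝ) < H)
          (by linarith : (0:ℝ) < t), pow_pos (by linarith : (0:ℝ) < H) 3,
          mul_nonneg (sub_nonneg.2 hH') (by linarith : (0:ℝ) ≤ t),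
          mul_nonneg (mul_nonneg (sub_nonneg.2 hH') (by linarith : (0:ℝ) ≤ t))
            (by linarith : (0:ℝ) ≤ H)]

theorem sum_weight_sq_le_of_any {H : ℕ} (hH : 0 < H) {t : ℕ} (ht : 1 ≤ t) (n : ℕ) :
    ∑ i ∈ Finset.range n, weight H t (i + 1) ^ 2 ≤ 2 * H / t := by
  refine le_trans ?_ (sum_weight_sq_le hH ht)
  rcases le_total n t with h | h
  · exact Finset.sum_le_sum_of_subset_of_nonneg (Finset.range_subset_range.2 h)
      fun _ _ _ => sq_nonneg _
  · refine (Finset.sum_subset (Finset.range_subset_range.2 h) fun i _ hi => ?_).ge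
    rw [weight_eq_zero (by simpa [Nat.lt_succ_iff] using hi)]; norm_num

/-- The result of averaging the values of `X` along a list with the learning rates. -/
def recAverage {S : Type*} (H : ℕ) (X : S → ℝ) (l : List S) : ℝ :=
  weightedSum (weight H l.length) X l

/-- This is the recursion of a table entry under updates, which is why the noise enters an entry
exactly as a `recAverage`. -/
theorem recAverage_concat {S : Type*} (H : ℕ) (X : S → ℝ) (l : List S) (x : S) :
    recAverage H X (l ++ [x]) = (1 - learningRate H (l.length + 1)) * recAverage H X l
      + learningRate H (l.length + 1) * X x := by
  unfold recAverage
  rw [weightedSum_concat, ← weightedSum_mul_left]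
  congr 1
  · refine weightedSum_congr _ _ fun i hi => ?_
    rw [List.length_append, List.length_singleton, weight, if_neg (by omega)]
  · simp [weight]

variable {S A : Type*} {H : ℕ}

open Classical in
/-- The next states observed at the visits of `(h, s, a)`, in chronological order. -/
def nexts (h : Fin H) (s : S) (a : A) (L : List (Transition S A H)) : List S :=
  (L.filter fun x => h = x.step ∧ s = x.state ∧ a = x.action).map Transition.next

@[simp] theorem nexts_nil (h : Fin H) (s : S) (a : A) : nexts h s a [] = [] := rfl

theorem nexts_append (h : Fin H) (s : S) (a : A) (L L' : List (Transition S A H)) :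
    nexts h s a (L ++ L') = nexts h s a L ++ nexts h s a L' := by simp [nexts]

open Classical in
theorem nexts_concat (h : Fin H) (s : S) (a : A) (L : List (Transition S A H))
    (x : Transition S A H) :
    nexts h s a (L ++ [x]) =
      if h = x.step ∧ s = x.state ∧ a = x.action then nexts h s a L ++ [x.next]
      else nexts h s a L := by
  rw [nexts_append]
  split_ifs with hx <;> simp [nexts, hx]

theorem length_nexts_le (h : Fin H) (s : S) (a : A) (L : List (Transition S A H)) :
    (nexts h s a L).length ≤ L.length := by
  simpa [nexts] using List.length_filter_le _ _

/-! ### Concentration -/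

theorem sum_toReal_pmf [Fintype S] (q : PMF S) : ∑ x, (q x).toReal = 1 := by
  rw [← ENNReal.toReal_sum fun x _ => q.apply_ne_top x, ← tsum_fintype (L := .unconditional S),
    q.tsum_coe, ENNReal.toReal_one]

/-- Hoeffding's lemma for a centred function with values in `[-1, 1]`. -/
theorem expect_exp_le [Fintype S] (q : PMF S) {X : S → ℝ} (hX : ∀ x, |X x| ≤ 1)
    (hq : ∑ x, (q x).toReal * X x = 0) (θ : ℝ) :
    expect q (fun x => ENNReal.ofReal (Real.exp (θ * X x))) ≤
      ENNReal.ofReal (Real.exp (θ ^ 2 / 2)) := by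
  have h2 : ∑ x, (q x).toReal * Real.exp (θ * X x) ≤ Real.exp (θ ^ 2 / 2) := by
    -- Convexity bounds the exponential on `[-1, 1]` by its chord; centring removes the `sinh` term.
    calc ∑ x, (q x).toReal * Real.exp (θ * X x)
        ≤ ∑ x, (q x).toReal * (Real.cosh θ + X x * Real.sinh θ) := by
          refine Finset.sum_le_sum fun x _ => ?_
          have := Real.exp_mul_le_cosh_add_mul_sinh (hX x) θ
          rw [mul_comm θ]
          gcongr
      _ = Real.cosh θ * ∑ x, (q x).toReal + Real.sinh θ * ∑ x, (q x).toReal * X x := by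
          rw [Finset.mul_sum, Finset.mul_sum, ← Finset.sum_add_distrib]
          exact Finset.sum_congr rfl fun x _ => by ring
      _ = Real.cosh θ := by rw [sum_toReal_pmf, hq]; ring
      _ ≤ _ := Real.cosh_le_exp_half_sq θ
  unfold expect
  rw [tsum_fintype]
  refine le_trans (le_of_eq ?_) (ENNReal.ofReal_le_ofReal h2)
  rw [ENNReal.ofReal_sum_of_nonneg fun x _ => by positivity]
  refine Finset.sum_congr rfl fun x _ => ?_
  rw [ENNReal.ofReal_mul ENNReal.toReal_nonneg, ENNReal.ofReal_toReal (q.apply_ne_top x)]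

/-- A visit of `(h, s, a)` multiplies the process by a factor of mean at most `1`, by Hoeffding's
lemma; any other transition leaves it unchanged. The weights must be fixed in advance. -/
theorem isSupermartingale_exp [Fintype S] (M : EpisodicMDP S A H) (h : Fin H) (s : S) (a : A)
    {X : S → ℝ} (hX : ∀ x, |X x| ≤ 1) (hP : ∑ x, (M.P h s a x).toReal * X x = 0) (u : ℕ → ℝ) :
    IsSupermartingale M fun L => ENNReal.ofReal (Real.exp (weightedSum u X (nexts h s a L)
      - (∑ i ∈ Finset.range (nexts h s a L).length, u (i + 1) ^ 2) / 2)) := by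
  intro L g y b
  by_cases hx : h = g ∧ s = y ∧ a = b
  · obtain ⟨rfl, rfl, rfl⟩ := hx
    simp only [nexts_concat, and_self, if_true, weightedSum_concat, List.length_append,
      List.length_singleton, Finset.sum_range_succ]
    set n := (nexts h s a L).length
    set Z := weightedSum u X (nexts h s a L)
    set V := ∑ i ∈ Finset.range n, u (i + 1) ^ 2
    have key : ∀ x, ENNReal.ofReal (Real.exp (Z + u (n + 1) * X x - (V + u (n + 1) ^ 2) / 2))
        = ENNReal.ofReal (Real.exp (u (n + 1) * X x))
          * ENNReal.ofReal (Real.exp (Z - (V + u (n + 1) ^ 2) / 2)) := fun x => by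
      rw [← ENNReal.ofReal_mul (Real.exp_nonneg _), ← Real.exp_add]; congr 2; ring
    simp_rw [key]
    have hm : ∀ c : ℝ≥0∞, expect (M.P h s a) (fun x =>
        ENNReal.ofReal (Real.exp (u (n + 1) * X x)) * c) = expect (M.P h s a) (fun x =>
        ENNReal.ofReal (Real.exp (u (n + 1) * X x))) * c := fun c => by
      simp only [expect, ← ENNReal.tsum_mul_right, mul_assoc]
    rw [hm]
    calc _ ≤ ENNReal.ofReal (Real.exp (u (n + 1) ^ 2 / 2))
          * ENNReal.ofReal (Real.exp (Z - (V + u (n + 1) ^ 2) / 2)) := by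
          gcongr; exact expect_exp_le _ hX hP _
      _ = _ := by
          rw [← ENNReal.ofReal_mul (Real.exp_nonneg _), ← Real.exp_add]; congr 2; ring
  · simp only [nexts_concat, hx, if_false, expect_const, le_refl]

theorem toOuterMeasure_weightedSum_le [Fintype S] (M : EpisodicMDP S A H)
    (act : ActionRule S A H) (K : ℕ) (h : Fin H) (s : S) (a : A)
    {X : S → ℝ} (hX : ∀ x, |X x| ≤ 1) (hP : ∑ x, (M.P h s a x).toReal * X x = 0)
    {t : ℕ} (ht : 1 ≤ t) {z : ℝ} (hz : 0 < z) {σ : ℝ} (hσ : σ ^ 2 = 1) :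
    (explore M act K).toOuterMeasure
        {D | z < σ * weightedSum (weight H t) X (nexts h s a D.flatten)} ≤
      ENNReal.ofReal (Real.exp (-(z ^ 2 * t / (4 * H)))) := by
  have hH : 0 < H := h.pos
  have hH' : (0 : ℝ) < H := by exact_mod_cast hH
  have ht' : (0 : ℝ) < t := by exact_mod_cast ht
  -- The maximizer of `θ z - θ² H / t`, with maximum `z² t / (4 H)`.
  set θ : ℝ := z * t / (2 * H) with hθ
  have hθ0 : 0 < θ := by positivity
  set e : ℝ := z ^ 2 * t / (4 * H) with he
  have hF := isSupermartingale_exp M h s a hX hP (fun i => (θ * σ) * weight H t i)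
  have hE := hF.expect_explore_le act K
  have hM := toOuterMeasure_lt_le (explore M act K) (fun D => ENNReal.ofReal (Real.exp
    (weightedSum (fun i => (θ * σ) * weight H t i) X (nexts h s a D.flatten)
      - (∑ i ∈ Finset.range (nexts h s a D.flatten).length,
        ((θ * σ) * weight H t (i + 1)) ^ 2) / 2))) (a := ENNReal.ofReal (Real.exp e))
    (by simp [Real.exp_pos]) ENNReal.ofReal_ne_top
  refine le_trans ((explore M act K).toOuterMeasure.mono fun D hD => ?_) (hM.trans ?_)
  · simp only [Set.mem_ofPred_eq] at hD ⊢
    rw [ENNReal.ofReal_lt_ofReal_iff (Real.exp_pos _), Real.exp_lt_exp, weightedSum_mul_left]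
    -- The final number of visits need not be `t`: weights beyond `t` vanish, and a shorter sum is
    -- smaller.
    have hs : (∑ i ∈ Finset.range (nexts h s a D.flatten).length,
        ((θ * σ) * weight H t (i + 1)) ^ 2) ≤ θ ^ 2 * (2 * H / t) := by
      calc _ = θ ^ 2 * ∑ i ∈ Finset.range (nexts h s a D.flatten).length,
            weight H t (i + 1) ^ 2 := by
            rw [Finset.mul_sum]
            refine Finset.sum_congr rfl fun i _ => ?_
            rw [mul_pow, mul_pow, hσ, mul_one]
        _ ≤ _ := by gcongr; exact sum_weight_sq_le_of_any hH ht _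
    have h2 : e = θ * z - θ ^ 2 * (2 * H / t) / 2 := by
      rw [he, hθ]; field_simp; ring
    have h3 := mul_lt_mul_of_pos_left hD hθ0
    rw [h2]
    linarith
  · calc _ ≤ (1 : ℝ≥0∞) / ENNReal.ofReal (Real.exp e) := by
          gcongr; simpa using hE
      _ = _ := by
          rw [Real.exp_neg, ENNReal.ofReal_inv_of_pos (Real.exp_pos _), one_div]

/-- A deviation bound at the end of the data, for all fixed numbers of visits, bounds the
averaged noise at every earlier time. -/
theorem abs_recAverage_le {X : S → ℝ} {h : Fin H} {s : S} {a : A} {b : ℕ → ℝ}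
    {L : List (Transition S A H)}
    (hb : ∀ t, 1 ≤ t → t ≤ L.length → |weightedSum (weight H t) X (nexts h s a L)| ≤ b t)
    {L' : List (Transition S A H)} (hL : L' <+: L) (hn : 1 ≤ (nexts h s a L').length) :
    |recAverage H X (nexts h s a L')| ≤ b (nexts h s a L').length := by
  have h1 := hb _ hn ((length_nexts_le h s a L').trans hL.length_le)
  obtain ⟨L'', rfl⟩ := hL
  -- With `t` the number of visits in `L'`, later visits have weight zero, so the sum over all data
  -- is the sum over `L'`. This avoids any stopping time.
  rwa [nexts_append, weightedSum_append_of_eq_zero _ _ _ fun i hi => weight_eq_zero hi] at h1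

end

section

/-! ### Optimism -/

variable {S A : Type*} {H : ℕ} [Fintype A] [Nonempty A]

/-- `Q` and `V` are the optimal values for the reward function `r`; all rewards-to-go lie in
`[0, 1]`. -/
structure IsOptimalValue [Fintype S] (M : EpisodicMDP S A H) (r : Fin H → S → A → S → ℝ)
    (Q : Fin H → S → A → ℝ) (V : ℕ → S → ℝ) : Prop where
  value_eq (h : Fin H) (s : S) : V h s = Finset.univ.sup' Finset.univ_nonempty (Q h s)
  last (s : S) : V H s = 0
  bellman (h : Fin H) (s : S) (a : A) :
    Q h s a = ∑ s', (M.P h s a s').toReal * (r h s a s' + V (h + 1) s')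
  mem_Icc (h : Fin H) (s : S) (a : A) (s' : S) : r h s a s' + V (h + 1) s' ∈ Set.Icc (0 : ℝ) 1

/-- The difference between the sampled and the expected one-step return. -/
def noise (r : Fin H → S → A → S → ℝ) (Q : Fin H → S → A → ℝ) (V : ℕ → S → ℝ) (h : Fin H)
    (s : S) (a : A) (s' : S) : ℝ :=
  r h s a s' + V (h + 1) s' - Q h s a

namespace IsOptimalValue

variable [Fintype S] {M : EpisodicMDP S A H} {r : Fin H → S → A → S → ℝ}
  {Q : Fin H → S → A → ℝ} {V : ℕ → S → ℝ}

theorem Q_mem_Icc (hQ : IsOptimalValue M r Q V) (h : Fin H) (s : S) (a : A) :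
    Q h s a ∈ Set.Icc (0 : ℝ) 1 := by
  rw [hQ.bellman]
  constructor
  · exact Finset.sum_nonneg fun x _ => mul_nonneg ENNReal.toReal_nonneg (hQ.mem_Icc h s a x).1
  · rw [← sum_toReal_pmf (M.P h s a)]
    exact Finset.sum_le_sum fun x _ =>
      mul_le_of_le_one_right ENNReal.toReal_nonneg (hQ.mem_Icc h s a x).2

theorem abs_noise_le (hQ : IsOptimalValue M r Q V) (h : Fin H) (s : S) (a : A) (s' : S) :
    |noise r Q V h s a s'| ≤ 1 := by
  have h1 := hQ.Q_mem_Icc h s a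
  have h2 := hQ.mem_Icc h s a s'
  rw [abs_le, noise]
  constructor <;> linarith [h1.1, h1.2, h2.1, h2.2]

theorem sum_noise (hQ : IsOptimalValue M r Q V) (h : Fin H) (s : S) (a : A) :
    ∑ s', (M.P h s a s').toReal * noise r Q V h s a s' = 0 := by
  simp only [noise, mul_sub, Finset.sum_sub_distrib, ← Finset.sum_mul, sum_toReal_pmf, one_mul]
  rw [hQ.bellman, sub_self]

end IsOptimalValue

/-- The truncated greedy value at step `n`, which is `0` for `n ≥ H`. -/
def Tables.valueAt (T : Tables S A H) (n : ℕ) (s : S) : ℝ :=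
  if hn : n < H then T.value ⟨n, hn⟩ s else 0

theorem Tables.nextValue_eq (T : Tables S A H) (h : Fin H) (s : S) :
    T.nextValue h s = T.valueAt (h + 1) s := rfl

theorem Tables.valueAt_nonneg {T : Tables S A H} (hT : ∀ h s a, 0 ≤ T.Q h s a) (n : ℕ) (s : S) :
    0 ≤ T.valueAt n s := by
  unfold Tables.valueAt
  split_ifs with hn
  · refine le_min (Nat.cast_nonneg _) ?_
    obtain ⟨a⟩ := ‹Nonempty A›
    exact (hT _ s a).trans (Finset.le_sup' (T.Q ⟨n, hn⟩ s) (Finset.mem_univ a))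
  · exact le_rfl

theorem Tables.valueAt_le (T : Tables S A H) (n : ℕ) (s : S) : T.valueAt n s ≤ H := by
  unfold Tables.valueAt
  split_ifs with hn
  · exact min_le_left _ _
  · exact Nat.cast_nonneg _

section

variable [Fintype S] {M : EpisodicMDP S A H} {r : Fin H → S → A → S → ℝ}
  {Q : Fin H → S → A → ℝ} {V : ℕ → S → ℝ}

/-- Truncation at `H` does no harm because the optimal value is at most `1 ≤ H`. -/
theorem IsOptimalValue.le_valueAt (hQ : IsOptimalValue M r Q V) {T : Tables S A H}
    (hT : ∀ h s a, Q h s a ≤ T.Q h s a) {n : ℕ} (hn : n ≤ H) (s : S) : V n s ≤ T.valueAt n s := by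
  rcases hn.lt_or_eq with hn | rfl
  · have hH : (1 : ℝ) ≤ H := by exact_mod_cast (by omega : 1 ≤ H)
    rw [Tables.valueAt, dif_pos hn, show V n s = _ from hQ.value_eq ⟨n, hn⟩ s]
    refine le_min (Finset.sup'_le _ _ fun a _ => (hQ.Q_mem_Icc _ s a).2.trans hH) ?_
    exact Finset.sup'_mono_fun fun a _ => hT _ s a
  · simp [Tables.valueAt, hQ.last]

/-- The maximum is subadditive; where the value of `U` is truncated to `H`, the bound holds because
`V` is nonnegative. -/
theorem IsOptimalValue.valueAt_le (hQ : IsOptimalValue M r Q V) {T U : Tables S A H}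
    (hU : ∀ h s a, T.Q h s a ≤ Q h s a + U.Q h s a)
    {n : ℕ} (hn : n ≤ H) (s : S) : T.valueAt n s ≤ V n s + U.valueAt n s := by
  rcases hn.lt_or_eq with hn | rfl
  · rw [Tables.valueAt, dif_pos hn, Tables.valueAt, dif_pos hn,
      show V n s = _ from hQ.value_eq ⟨n, hn⟩ s, Tables.value, Tables.value, ← min_add_add_left]
    have hmax := fun a => Finset.le_sup' (Q ⟨n, hn⟩ s) (Finset.mem_univ a)
    refine le_min ((min_le_left _ _).trans ?_) ((min_le_right _ _).trans ?_)
    · obtain ⟨a⟩ := ‹Nonempty A›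
      linarith [hmax a, (hQ.Q_mem_Icc ⟨n, hn⟩ s a).1]
    · refine Finset.sup'_le _ _ fun a _ => (hU _ s a).trans (add_le_add (hmax a) ?_)
      exact Finset.le_sup' (U.Q ⟨n, hn⟩ s) (Finset.mem_univ a)
  · simp [Tables.valueAt, hQ.last]

end

theorem learn_concat (b : ℕ → ℝ) (r : Fin H → S → A → S → ℝ) (L : List (Transition S A H))
    (x : Transition S A H) : learn b r (L ++ [x]) = (learn b r L).update b r x := by
  simp [learn]

theorem learn_count (b : ℕ → ℝ) (r : Fin H → S → A → S → ℝ) (L : List (Transition S A H))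
    (h : Fin H) (s : S) (a : A) : (learn b r L).count h s a = (nexts h s a L).length := by
  induction L using List.reverseRecOn with
  | nil => rfl
  | append_singleton L x ih =>
    rw [learn_concat, nexts_concat]
    simp only [Tables.update]
    split_ifs <;> simp [ih]

/-- The average of the bonuses with the learning rates. -/
def avgBonus (H : ℕ) (b : ℕ → ℝ) : ℕ → ℝ
  | 0 => 0
  | t + 1 => (1 - learningRate H (t + 1)) * avgBonus H b t + learningRate H (t + 1) * b (t + 1)

/-- Since `α_1 = 1`, this is a genuine weighted average of `b 1, …, b t`, and the last of these is
the smallest. -/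
theorem le_avgBonus {b : ℕ → ℝ} (hb : ∀ t, 1 ≤ t → b (t + 1) ≤ b t) {t : ℕ} (ht : 1 ≤ t) :
    b t ≤ avgBonus H b t := by
  induction t, ht using Nat.le_induction with
  | base => simp [avgBonus, learningRate_one]
  | succ t ht ih =>
    have h1 := learningRate_le_one (H := H) (t := t + 1) (by omega)
    rw [avgBonus]
    nlinarith [mul_le_mul_of_nonneg_left ((hb t ht).trans ih) (sub_nonneg.2 h1)]

/-- Averaged noise and averaged bonus obey the same recursion as the table entries, so keeping both
exactly, rather than only their bounds, closes the induction. Once the noise is below the bonus, the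
first inequality is optimism and the second bounds the excess by the pseudo-table, whose second copy
of the bonus absorbs the noise. -/
theorem IsOptimalValue.learn_bounds [Fintype S] {M : EpisodicMDP S A H}
    {r : Fin H → S → A → S → ℝ} {Q : Fin H → S → A → ℝ} {V : ℕ → S → ℝ}
    (hQ : IsOptimalValue M r Q V) {b : ℕ → ℝ} {L : List (Transition S A H)}
    (hW : ∀ L', L' <+: L → ∀ h s a, |recAverage H (noise r Q V h s a) (nexts h s a L')| ≤
      avgBonus H b (nexts h s a L').length) (h : Fin H) (s : S) (a : A) :
    recAverage H (noise r Q V h s a) (nexts h s a L) + avgBonus H b (nexts h s a L).length ≤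
        (learn b r L).Q h s a - Q h s a ∧
      (learn b r L).Q h s a - Q h s a - recAverage H (noise r Q V h s a) (nexts h s a L)
        + avgBonus H b (nexts h s a L).length ≤ (pseudoTables b L).Q h s a := by
  induction L using List.reverseRecOn generalizing h s a with
  | nil =>
    -- Before any visit noise and bonus are zero, both tables equal `H`, and `0 ≤ Q ≤ 1 ≤ H`.
    have h1 := hQ.Q_mem_Icc h s a
    have hH : (1 : ℝ) ≤ H := by exact_mod_cast h.pos
    simp only [nexts_nil, recAverage, weightedSum_nil, List.length_nil, avgBonus, learn,
      pseudoTables, List.foldl_nil, Tables.init]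
    constructor <;> linarith [h1.1, h1.2]
  | append_singleton L x ih =>
    have hW' : ∀ L', L' <+: L → ∀ h s a,
        |recAverage H (noise r Q V h s a) (nexts h s a L')| ≤
          avgBonus H b (nexts h s a L').length :=
      fun L' hL' => hW L' (hL'.trans (List.prefix_append _ _))
    have ih := ih hW'
    have hlow : ∀ h s a, Q h s a ≤ (learn b r L).Q h s a := fun h s a => by
      linarith [(ih h s a).1, (abs_le.1 (hW' L List.prefix_rfl h s a)).1]
    have hup : ∀ h s a, (learn b r L).Q h s a ≤ Q h s a + (pseudoTables b L).Q h s a :=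
      fun h s a => by
        linarith [(ih h s a).2, (abs_le.1 (hW' L List.prefix_rfl h s a)).2]
    specialize ih h s a
    rw [pseudoTables] at ih hup ⊢
    rw [nexts_concat, learn_concat, learn_concat]
    simp only [Tables.update, learn_count]
    split_ifs with hx
    · set t := (nexts h s a L).length
      have h1 := learningRate_le_one (H := H) (t := t + 1) (by omega)
      have h0 := learningRate_pos (H := H) (t := t + 1) (by omega)
      have hV1 := hQ.le_valueAt hlow (n := h + 1) h.isLt x.next
      have hV2 := hQ.valueAt_le hup (n := h + 1) h.isLt x.next
      rw [recAverage_concat, List.length_append, List.length_singleton, avgBonus,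
        Tables.nextValue_eq, Tables.nextValue_eq]
      set α := learningRate H (t + 1)
      set W := recAverage H (noise r Q V h s a) (nexts h s a L)
      have e1 := mul_le_mul_of_nonneg_left ih.1 (sub_nonneg.2 h1)
      have e2 := mul_le_mul_of_nonneg_left ih.2 (sub_nonneg.2 h1)
      have e3 := mul_le_mul_of_nonneg_left hV1 h0.le
      have e4 := mul_le_mul_of_nonneg_left hV2 h0.le
      rw [noise]
      constructor <;> linarith
    · exact ih

theorem IsOptimalValue.valueAt_learn_mem [Fintype S] {M : EpisodicMDP S A H}
    {r : Fin H → S → A → S → ℝ} {Q : Fin H → S → A → ℝ} {V : ℕ → S → ℝ}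
    (hQ : IsOptimalValue M r Q V) {b : ℕ → ℝ} {L : List (Transition S A H)}
    (hW : ∀ L', L' <+: L → ∀ h s a, |recAverage H (noise r Q V h s a) (nexts h s a L')| ≤
      avgBonus H b (nexts h s a L').length) {n : ℕ} (hn : n ≤ H) (s : S) :
    V n s ≤ (learn b r L).valueAt n s ∧
      (learn b r L).valueAt n s ≤ V n s + (pseudoTables b L).valueAt n s := by
  have hB := hQ.learn_bounds hW
  have hA := hW L List.prefix_rfl
  exact ⟨hQ.le_valueAt (fun h s a => by linarith [(hB h s a).1, (abs_le.1 (hA h s a)).1]) hn s,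
    hQ.valueAt_le (fun h s a => by linarith [(hB h s a).2, (abs_le.1 (hA h s a)).2]) hn s⟩

end

section

/-! ### The pseudo-values along the exploration phase -/

variable {S A : Type*} {H : ℕ} [Fintype A] [Nonempty A]

theorem pseudoTables_nonneg {b : ℕ → ℝ} (hb : ∀ t, 0 ≤ b t) (L : List (Transition S A H))
    (h : Fin H) (s : S) (a : A) : 0 ≤ (pseudoTables b L).Q h s a := by
  induction L using List.reverseRecOn generalizing h s a with
  | nil => simp [pseudoTables, learn, Tables.init]
  | append_singleton L x ih =>
    rw [pseudoTables] at ih ⊢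
    rw [learn_concat]
    simp only [Tables.update]
    split_ifs
    · set t := (learn (fun t => 2 * b t) (fun _ _ _ _ => 0) L).count h s a
      have h1 := learningRate_le_one (H := H) (t := t + 1) (by omega)
      have h0 := learningRate_pos (H := H) (t := t + 1) (by omega)
      have h2 := Tables.valueAt_nonneg ih (h + 1) x.next
      rw [← Tables.nextValue_eq] at h2
      have h3 := hb (t + 1)
      have h4 := mul_nonneg (sub_nonneg.2 h1) (ih h s a)
      have h5 := mul_nonneg h0.le (by linarith : 0 ≤ 0 +
        (learn (fun t => 2 * b t) (fun _ _ _ _ => 0) L).nextValue h x.next + 2 * b (t + 1))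
      linarith
    · exact ih h s a

/-- The factor `1 + 1/H` by which errors grow from one step to the previous one. -/
def growth (H : ℕ) : ℝ := 1 + 1 / H

theorem one_le_growth (H : ℕ) : 1 ≤ growth H := by
  unfold growth
  have : (0 : ℝ) ≤ 1 / H := by positivity
  linarith

theorem growth_pow_le {n : ℕ} (hn : n ≤ H) : growth H ^ n ≤ 3 := by
  rcases Nat.eq_zero_or_pos H with rfl | hH
  · simp [Nat.le_zero.1 hn]
  · calc growth H ^ n ≤ growth H ^ H := pow_le_pow_right₀ (one_le_growth H) hn
      _ ≤ Real.exp (1 / H) ^ H := by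
        refine pow_le_pow_left₀ (zero_le_one.trans (one_le_growth H)) ?_ _
        have := Real.add_one_le_exp (1 / (H : ℝ))
        unfold growth; linarith
      _ = Real.exp 1 := by
        rw [← Real.exp_nat_mul, mul_one_div_cancel]; positivity
      _ ≤ 3 := by linarith [Real.exp_one_lt_d9]

/-- The contribution of one entry of the tables at step `h` to the potential. -/
def entryPotential (H : ℕ) (β : ℝ) (h : ℕ) (t : ℕ) (q : ℝ) : ℝ :=
  growth H ^ h * ((1 + t / H) * q - growth H * (4 * β * Real.sqrt t))

theorem one_div_sqrt_le (t : ℕ) :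
    1 / Real.sqrt ((t + 1 : ℕ) : ℝ) ≤ 2 * (Real.sqrt ((t + 1 : ℕ) : ℝ) - Real.sqrt t) := by
  have h1 : 0 < Real.sqrt ((t + 1 : ℕ) : ℝ) := Real.sqrt_pos.2 (by positivity)
  rw [div_le_iff₀ h1]
  have h2 := Real.sq_sqrt (show (0 : ℝ) ≤ ((t + 1 : ℕ) : ℝ) by positivity)
  have h3 := Real.sq_sqrt (show (0 : ℝ) ≤ (t : ℝ) by positivity)
  push_cast at *
  nlinarith [sq_nonneg (Real.sqrt ((t : ℝ) + 1) - Real.sqrt t)]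

/-- The change of the potential at an update of an entry. -/
theorem entryPotential_update_le {β : ℝ} (hβ : 0 ≤ β) (hH : 0 < H) (h t : ℕ) (q v : ℝ) :
    entryPotential H β h (t + 1) ((1 - learningRate H (t + 1)) * q
        + learningRate H (t + 1) * (v + 2 * (β / Real.sqrt ((t + 1 : ℕ) : ℝ))))
      ≤ entryPotential H β h t q - growth H ^ h * q + growth H ^ (h + 1) * v := by
  have hH' : (0 : ℝ) < H := by exact_mod_cast hH
  have hg : 0 < growth H := zero_lt_one.trans_le (one_le_growth H)
  have hr : learningRate H (t + 1) = growth H * H / (H + t + 1) := by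
    unfold learningRate growth; push_cast; field_simp; ring
  -- The coefficient `1 + t / H` is chosen so that an update releases exactly one copy of the old
  -- entry and brings in the target with factor `growth H`.
  have h1 : (1 + ((t + 1 : ℕ) : ℝ) / H) * (1 - learningRate H (t + 1)) = t / H := by
    rw [one_sub_learningRate]; push_cast; field_simp; ring
  have h2 : (1 + ((t + 1 : ℕ) : ℝ) / H) * learningRate H (t + 1) = growth H := by
    rw [hr]; push_cast; field_simp; ring
  -- The decrease of the term `-4 β √t` pays for the bonus `2 β / √(t + 1)`.
  have h3 : β / Real.sqrt ((t + 1 : ℕ) : ℝ) ≤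
      β * (2 * (Real.sqrt ((t + 1 : ℕ) : ℝ) - Real.sqrt t)) := by
    rw [div_eq_mul_one_div]; exact mul_le_mul_of_nonneg_left (one_div_sqrt_le t) hβ
  unfold entryPotential
  set d := β / Real.sqrt ((t + 1 : ℕ) : ℝ)
  set α := learningRate H (t + 1)
  have h4 : (1 + ((t + 1 : ℕ) : ℝ) / H) * ((1 - α) * q + α * (v + 2 * d))
      = t / H * q + growth H * (v + 2 * d) := by
    rw [mul_add, ← mul_assoc, ← mul_assoc, h1, h2]
  have h5 := mul_le_mul_of_nonneg_left h3 (mul_pos (pow_pos hg h) hg).le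
  rw [h4]
  linear_combination 2 * h5

/-- The next value brought in by an update is thus still the value from which the following step
starts, so the charges telescope within an episode. -/
theorem valueAt_pseudoTables_concat (b : ℕ → ℝ) (L : List (Transition S A H))
    (x : Transition S A H) (s : S) :
    (pseudoTables b (L ++ [x])).valueAt (x.step + 1) s
      = (pseudoTables b L).valueAt (x.step + 1) s := by
  unfold Tables.valueAt
  split_ifs with hn
  · have : ∀ a, (pseudoTables b (L ++ [x])).Q ⟨x.step + 1, hn⟩ s a
        = (pseudoTables b L).Q ⟨x.step + 1, hn⟩ s a := fun a => by
      simp [pseudoTables, learn_concat, Tables.update, Fin.ext_iff]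
    rw [Tables.value, Tables.value, funext this]
  · rfl

/-- The potential of the tables. -/
def potential [Fintype S] (β : ℝ) (T : Tables S A H) : ℝ :=
  ∑ i : Fin H × S × A, entryPotential H β i.1 (T.count i.1 i.2.1 i.2.2) (T.Q i.1 i.2.1 i.2.2)

/-- The potential minus the scaled value of the current state does not grow along a greedy
episode. -/
theorem potential_concat_le [Fintype S] {β : ℝ} (hβ : 0 ≤ β) {b : ℕ → ℝ}
    (hb : ∀ t : ℕ, b t = β / Real.sqrt t) (L : List (Transition S A H)) (x : Transition S A H)
    (hx : ∀ a, (pseudoTables b L).Q x.step x.state a ≤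
      (pseudoTables b L).Q x.step x.state x.action) :
    potential β (pseudoTables b (L ++ [x]))
        - growth H ^ (x.step + 1 : ℕ) * (pseudoTables b (L ++ [x])).valueAt (x.step + 1) x.next
      ≤ potential β (pseudoTables b L)
        - growth H ^ (x.step : ℕ) * (pseudoTables b L).valueAt x.step x.state := by
  classical
  have hg : 0 < growth H := zero_lt_one.trans_le (one_le_growth H)
  rw [valueAt_pseudoTables_concat]
  -- Greediness enters here: the entry released by the update dominates the value of the current
  -- state.
  have hV : (pseudoTables b L).valueAt x.step x.state
      ≤ (pseudoTables b L).Q x.step x.state x.action := by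
    rw [Tables.valueAt, dif_pos x.step.isLt]
    exact (min_le_right _ _).trans (Finset.sup'_le _ _ fun a _ => hx a)
  have hV' := mul_le_mul_of_nonneg_left hV (pow_pos hg x.step).le
  have hsum : potential β (pseudoTables b (L ++ [x])) - potential β (pseudoTables b L)
      = entryPotential H β x.step ((pseudoTables b (L ++ [x])).count x.step x.state x.action)
          ((pseudoTables b (L ++ [x])).Q x.step x.state x.action)
        - entryPotential H β x.step ((pseudoTables b L).count x.step x.state x.action)
          ((pseudoTables b L).Q x.step x.state x.action) := by
    unfold potential
    rw [← Finset.sum_sub_distrib]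
    refine Finset.sum_eq_single (x.step, x.state, x.action) (fun i _ hi => ?_) (by simp)
    have hi' : ¬ (i.1 = x.step ∧ i.2.1 = x.state ∧ i.2.2 = x.action) := fun h =>
      hi (Prod.ext h.1 (Prod.ext h.2.1 h.2.2))
    simp [pseudoTables, learn_concat, Tables.update, hi']
  have hup := entryPotential_update_le hβ x.step.pos x.step
    ((pseudoTables b L).count x.step x.state x.action)
    ((pseudoTables b L).Q x.step x.state x.action)
    ((pseudoTables b L).valueAt (x.step + 1) x.next)
  have hq : (pseudoTables b (L ++ [x])).count x.step x.state x.action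
        = (pseudoTables b L).count x.step x.state x.action + 1 ∧
      (pseudoTables b (L ++ [x])).Q x.step x.state x.action
        = (1 - learningRate H ((pseudoTables b L).count x.step x.state x.action + 1))
            * (pseudoTables b L).Q x.step x.state x.action
          + learningRate H ((pseudoTables b L).count x.step x.state x.action + 1)
            * ((pseudoTables b L).valueAt (x.step + 1) x.next + 2 * (β / Real.sqrt
              (((pseudoTables b L).count x.step x.state x.action + 1 : ℕ) : ℝ))) := by
    simp only [pseudoTables, learn_concat, Tables.update, and_self, if_true, Tables.nextValue_eq,
      hb, zero_add]
  rw [← hq.2, ← hq.1] at hup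
  linarith

theorem rollout_potential_le [Fintype S] {M : EpisodicMDP S A H} {β : ℝ} (hβ : 0 ≤ β) {b : ℕ → ℝ}
    (hb : ∀ t : ℕ, b t = β / Real.sqrt t) {act : ActionRule S A H} (hact : IsGreedy b act)
    (L : List (Transition S A H)) {n : ℕ} (hn : n ≤ H) {es : List (Transition S A H) × S}
    (hes : es ∈ (rollout M act L n).support) :
    es.1.length = n ∧
      potential β (pseudoTables b (L ++ es.1))
          - growth H ^ n * (pseudoTables b (L ++ es.1)).valueAt n es.2
        ≤ potential β (pseudoTables b L) - (pseudoTables b L).valueAt 0 M.start := by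
  induction n generalizing es with
  | zero =>
    simp only [rollout, PMF.support_pure, Set.mem_singleton_iff] at hes
    subst hes
    simp
  | succ n ih =>
    simp only [rollout, dif_pos (show n < H from hn), PMF.mem_support_bind_iff,
      PMF.mem_support_map_iff] at hes
    obtain ⟨es₀, h0, a, ha, s', -, rfl⟩ := hes
    obtain ⟨h1, h2⟩ := ih (by omega) h0
    refine ⟨by simp [h1], le_trans ?_ h2⟩
    have := potential_concat_le hβ hb (L ++ es₀.1) ⟨⟨n, hn⟩, es₀.2, a, s'⟩
      (hact _ _ _ a ha)
    simpa [List.append_assoc] using this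

theorem explore_potential_le [Fintype S] {M : EpisodicMDP S A H} {β : ℝ} (hβ : 0 ≤ β) {b : ℕ → ℝ}
    (hb : ∀ t : ℕ, b t = β / Real.sqrt t) {act : ActionRule S A H} (hact : IsGreedy b act)
    {K : ℕ} {D : List (List (Transition S A H))} (hD : D ∈ (explore M act K).support) :
    D.length = K ∧ D.flatten.length = K * H ∧
      ∑ k ∈ Finset.range K, (pseudoTables b (D.take k).flatten).valueAt 0 M.start
          + potential β (pseudoTables b D.flatten)
        ≤ potential β (pseudoTables b ([] : List (Transition S A H))) := by
  induction K generalizing D with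
  | zero =>
    simp only [explore, PMF.support_pure, Set.mem_singleton_iff] at hD
    subst hD
    simp
  | succ K ih =>
    simp only [explore, PMF.mem_support_bind_iff, PMF.mem_support_map_iff] at hD
    obtain ⟨D, h0, es, hes, rfl⟩ := hD
    obtain ⟨h1, h2, h3⟩ := ih h0
    obtain ⟨h4, h5⟩ := rollout_potential_le hβ hb hact D.flatten le_rfl hes
    -- The value after the last step vanishes, so a full episode lowers the potential by at least
    -- the pseudo-value at its start.
    have h6 : ∀ T : Tables S A H, ∀ s, T.valueAt H s = 0 := fun T s => by simp [Tables.valueAt]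
    rw [h6, mul_zero, sub_zero] at h5
    refine ⟨by simp [h1], by simp only [List.flatten_append, List.length_append, h2,
      List.flatten_singleton, h4]; ring, ?_⟩
    rw [Finset.sum_range_succ, List.take_append_of_le_length h1.ge, List.take_of_length_le h1.le,
      List.flatten_append, List.flatten_singleton]
    have h7 : ∑ k ∈ Finset.range K,
        (pseudoTables b ((D ++ [es.1]).take k).flatten).valueAt 0 M.start
        = ∑ k ∈ Finset.range K, (pseudoTables b (D.take k).flatten).valueAt 0 M.start :=
      Finset.sum_congr rfl fun k hk => by
        rw [List.take_append_of_le_length (h1 ▸ (Finset.mem_range.1 hk).le)]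
    rw [h7]
    linarith

theorem sum_count [Fintype S] (b : ℕ → ℝ) (L : List (Transition S A H)) :
    ∑ i : Fin H × S × A, (pseudoTables b L).count i.1 i.2.1 i.2.2 = L.length := by
  classical
  induction L using List.reverseRecOn with
  | nil => simp [pseudoTables, learn, Tables.init]
  | append_singleton L x ih =>
    rw [List.length_append, List.length_singleton, ← ih]
    have : ∀ i : Fin H × S × A, (pseudoTables b (L ++ [x])).count i.1 i.2.1 i.2.2
        = (pseudoTables b L).count i.1 i.2.1 i.2.2
          + if i = (x.step, x.state, x.action) then 1 else 0 := fun i => by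
      simp only [pseudoTables, learn_concat, Tables.update, Prod.ext_iff]
      split_ifs <;> rfl
    simp [this, Finset.sum_add_distrib]

theorem potential_init_le [Fintype S] {β : ℝ} (b : ℕ → ℝ) :
    potential β (pseudoTables b ([] : List (Transition S A H)))
      ≤ 3 * (Fintype.card S * Fintype.card A * (H : ℝ) ^ 2) := by
  calc potential β (pseudoTables b ([] : List (Transition S A H)))
      = ∑ i : Fin H × S × A, growth H ^ (i.1 : ℕ) * H := by
        simp [potential, pseudoTables, learn, Tables.init, entryPotential]
    _ ≤ ∑ i : Fin H × S × A, (3 : ℝ) * H :=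
        Finset.sum_le_sum fun i _ =>
          mul_le_mul_of_nonneg_right (growth_pow_le i.1.isLt.le) (Nat.cast_nonneg _)
    _ = _ := by simp; ring

theorem neg_potential_le [Fintype S] {β : ℝ} (hβ : 0 ≤ β) {b : ℕ → ℝ} (hb : ∀ t, 0 ≤ b t)
    (L : List (Transition S A H)) :
    -potential β (pseudoTables b L) ≤
      12 * β * Real.sqrt ((H * Fintype.card S * Fintype.card A : ℕ) * L.length) := by
  have hg : 0 < growth H := zero_lt_one.trans_le (one_le_growth H)
  set n : Fin H × S × A → ℕ := fun i => (pseudoTables b L).count i.1 i.2.1 i.2.2 with hn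
  -- The entries are nonnegative, so only the square-root terms remain, with constant `12 = 3 * 4`
  -- as `growth H ^ (h + 1) ≤ 3`. Cauchy-Schwarz over the `H S A` entries follows.
  calc -potential β (pseudoTables b L)
      ≤ ∑ i : Fin H × S × A, 12 * β * Real.sqrt (n i) := by
        rw [potential, ← Finset.sum_neg_distrib]
        refine Finset.sum_le_sum fun i _ => ?_
        have h1 := pseudoTables_nonneg hb L i.1 i.2.1 i.2.2
        have h2 : growth H ^ ((i.1 : ℕ) + 1) ≤ 3 := growth_pow_le i.1.isLt
        have h3 : 0 ≤ growth H ^ (i.1 : ℕ) * ((1 + (n i : ℝ) / H)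
            * (pseudoTables b L).Q i.1 i.2.1 i.2.2) := by positivity
        have h4 := mul_le_mul_of_nonneg_right h2
          (by positivity : 0 ≤ 4 * β * Real.sqrt (n i))
        rw [pow_succ] at h4
        unfold entryPotential
        linarith
    _ = 12 * β * ∑ i : Fin H × S × A, Real.sqrt (n i) := by rw [Finset.mul_sum]
    _ ≤ _ := by
        gcongr
        refine Real.le_sqrt_of_sq_le ?_
        have h1 := sq_sum_le_card_mul_sum_sq (s := (Finset.univ : Finset (Fin H × S × A)))
          (f := fun i => Real.sqrt (n i))
        refine h1.trans (le_of_eq ?_)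
        rw [← sum_count b L]
        push_cast
        congr 1
        · simp; ring
        · exact Finset.sum_congr rfl fun i _ => Real.sq_sqrt (Nat.cast_nonneg _)

/-- The sum of the pseudo-values at the starting state. -/
theorem sum_valueAt_pseudoTables_le [Fintype S] {M : EpisodicMDP S A H} {β : ℝ} (hβ : 0 ≤ β)
    {b : ℕ → ℝ} (hb : ∀ t : ℕ, b t = β / Real.sqrt t) {act : ActionRule S A H}
    (hact : IsGreedy b act) {K : ℕ} {D : List (List (Transition S A H))}
    (hD : D ∈ (explore M act K).support) :
    ∑ k ∈ Finset.range K, (pseudoTables b (D.take k).flatten).valueAt 0 M.start ≤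
      3 * (Fintype.card S * Fintype.card A * (H : ℝ) ^ 2)
        + 12 * β * (H * Real.sqrt (Fintype.card S * Fintype.card A * K)) := by
  have hb0 : ∀ t, 0 ≤ b t := fun t => by rw [hb]; positivity
  obtain ⟨-, h2, h3⟩ := explore_potential_le hβ hb hact hD
  have h4 := potential_init_le (S := S) (A := A) (H := H) (β := β) b
  have h5 := neg_potential_le hβ hb0 D.flatten
  have h6 : Real.sqrt ((H * Fintype.card S * Fintype.card A : ℕ) * (D.flatten.length : ℝ))
      = H * Real.sqrt (Fintype.card S * Fintype.card A * K) := by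
    rw [h2, ← Real.sqrt_sq (Nat.cast_nonneg (α := ℝ) H), ← Real.sqrt_mul (by positivity)]
    congr 1; push_cast; ring
  rw [h6] at h5
  linarith

end

section

/-! ### Optimal values of the indicator rewards -/

variable {S A : Type*} {H : ℕ}

open Classical in
/-- The maximal probability of being in `s` at step `h`, when starting `j` steps earlier in a
given state. -/
def reachFrom (M : EpisodicMDP S A H) (h : Fin H) (s : S) : ℕ → S → ℝ≥0∞
  | 0, x => if x = s then 1 else 0
  | j + 1, x => ⨆ a, expect (M.P ⟨h - (j + 1), (Nat.sub_le _ _).trans_lt h.isLt⟩ x a)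
      (reachFrom M h s j)

theorem reachFrom_le_one (M : EpisodicMDP S A H) (h : Fin H) (s : S) (j : ℕ) (x : S) :
    reachFrom M h s j x ≤ 1 := by
  induction j generalizing x with
  | zero => rw [reachFrom]; split_ifs <;> simp
  | succ j ih => exact iSup_le fun a => expect_le _ ih

theorem reachFrom_sub (M : EpisodicMDP S A H) {h : Fin H} (s : S) {g : Fin H} (hg : g < h)
    (x : S) :
    reachFrom M h s (h - g) x = ⨆ a, expect (M.P g x a) (reachFrom M h s (h - (g + 1))) := by
  have h1 : (h : ℕ) - g = (h - (g + 1)) + 1 := by have := Fin.lt_def.1 hg; omega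
  rw [h1, reachFrom]
  have h2 : (⟨h - ((h - (g + 1)) + 1), (Nat.sub_le _ _).trans_lt h.isLt⟩ : Fin H) = g := by
    apply Fin.ext
    have := Fin.lt_def.1 hg
    simp only
    omega
  rw [h2]

theorem expect_reachFrom_zero (M : EpisodicMDP S A H) (h : Fin H) (s : S) (q : PMF S) :
    expect q (reachFrom M h s 0) = q s := by
  classical
  unfold expect
  rw [tsum_eq_single s]
  · simp [reachFrom]
  · intro x hx; simp [reachFrom, hx]

theorem expect_stateLaw_succ (M : EpisodicMDP S A H) (π : Policy S A H) (g : Fin H)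
    (f : S → ℝ≥0∞) :
    expect (stateLaw M π (g + 1)) f =
      expect (stateLaw M π g) fun x => expect (π g x) fun a => expect (M.P g x a) f := by
  rw [stateLaw, dif_pos g.isLt, expect_bind]
  simp only [expect_bind]

/-- Going backwards in `n`, replacing the action of `π` by the best one can only increase the chance
of reaching `s`. -/
theorem stateLaw_le_expect_reachFrom (M : EpisodicMDP S A H) (π : Policy S A H) (h : Fin H)
    (s : S) {n : ℕ} (hn : n ≤ h) :
    stateLaw M π h s ≤ expect (stateLaw M π n) (reachFrom M h s (h - n)) := by
  induction hn using Nat.decreasingInduction with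
  | self => rw [Nat.sub_self, expect_reachFrom_zero]
  | of_succ n hn ih =>
    refine ih.trans ?_
    rw [expect_stateLaw_succ M π ⟨n, hn.trans h.isLt⟩]
    refine expect_mono _ fun x => expect_le _ fun a => ?_
    rw [reachFrom_sub M s (g := ⟨n, hn.trans h.isLt⟩) hn]
    exact le_iSup (fun a => expect (M.P ⟨n, hn.trans h.isLt⟩ x a) _) a

/-- Dynamic programming: no policy beats the backward recursion, and with finitely many actions the
deterministic policy of its maximizers attains it. -/
theorem iSup_stateLaw [Finite A] [Nonempty A] (M : EpisodicMDP S A H) (h : Fin H) (s : S) :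
    ⨆ π : Policy S A H, stateLaw M π h s = reachFrom M h s h M.start := by
  apply le_antisymm
  · refine iSup_le fun π => (stateLaw_le_expect_reachFrom M π h s (Nat.zero_le _)).trans ?_
    rw [stateLaw, expect_pure, Nat.sub_zero]
  · have hex : ∀ (g : Fin H) (x : S), ∃ a, expect (M.P g x a) (reachFrom M h s (h - (g + 1))) =
        ⨆ a, expect (M.P g x a) (reachFrom M h s (h - (g + 1))) := fun g x =>
      exists_eq_ciSup_of_finite
    choose act hact using hex
    refine le_iSup_of_le (fun g x => PMF.pure (act g x)) ?_
    have key : ∀ n ≤ (h : ℕ), expect (stateLaw M (fun g x => PMF.pure (act g x)) n)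
        (reachFrom M h s (h - n)) = reachFrom M h s h M.start := by
      intro n
      induction n with
      | zero => intro _; rw [stateLaw, expect_pure, Nat.sub_zero]
      | succ n ih =>
        intro hn
        rw [← ih (by omega), expect_stateLaw_succ M _ ⟨n, lt_of_lt_of_le hn h.isLt.le⟩]
        congr 1
        funext x
        rw [expect_pure, reachFrom_sub M s (g := ⟨n, lt_of_lt_of_le hn h.isLt.le⟩) hn, ← hact]
    rw [← key h le_rfl, Nat.sub_self, expect_reachFrom_zero]

theorem toReal_expect [Fintype S] (q : PMF S) {f : S → ℝ≥0∞} (hf : ∀ x, f x ≤ 1) :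
    (expect q f).toReal = ∑ x, (q x).toReal * (f x).toReal := by
  unfold expect
  rw [tsum_fintype, ENNReal.toReal_sum fun x _ =>
    ENNReal.mul_ne_top (q.apply_ne_top x) ((hf x).trans_lt ENNReal.one_lt_top).ne]
  simp only [ENNReal.toReal_mul]

open Classical in
/-- If a reward is paid only at step `h`, and its largest conditional mean is `κ` in the state
`s` and `0` elsewhere, then its optimal value is `κ` times the reachability of `s`. -/
theorem exists_isOptimalValue [Fintype S] [Fintype A] [Nonempty A] (M : EpisodicMDP S A H)
    (h : Fin H) (s : S) {κ : ℝ} (hκ : κ ∈ Set.Icc (0 : ℝ) 1) {r : Fin H → S → A → S → ℝ}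
    (hr0 : ∀ g, g ≠ h → r g = 0) (hr : ∀ x a x', r h x a x' ∈ Set.Icc (0 : ℝ) 1)
    (hle : ∀ x a, ∑ x', (M.P h x a x').toReal * r h x a x' ≤ if x = s then κ else 0)
    (hex : ∀ x, ∃ a, (if x = s then κ else 0) ≤ ∑ x', (M.P h x a x').toReal * r h x a x') :
    ∃ Q V, IsOptimalValue M r Q V ∧ V 0 M.start = κ * reachability M h s := by
  set V : ℕ → S → ℝ := fun n x => if n ≤ (h : ℕ) then κ * (reachFrom M h s (h - n) x).toReal else 0
    with hV
  have hVI : ∀ n x, V n x ∈ Set.Icc (0 : ℝ) 1 := fun n x => by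
    simp only [hV]
    split_ifs
    · have h1 : (reachFrom M h s (h - n) x).toReal ≤ 1 := by
        have := ENNReal.toReal_mono ENNReal.one_ne_top (reachFrom_le_one M h s (h - n) x)
        simpa using this
      exact ⟨mul_nonneg hκ.1 ENNReal.toReal_nonneg, mul_le_one₀ hκ.2 ENNReal.toReal_nonneg h1⟩
    · simp
  refine ⟨fun g x a => ∑ x', (M.P g x a x').toReal * (r g x a x' + V (g + 1) x'), V,
    ⟨fun g x => ?_, fun x => ?_, fun _ _ _ => rfl, fun g x a x' => ?_⟩, ?_⟩
  · suffices hs : (∀ a, ∑ x', (M.P g x a x').toReal * (r g x a x' + V (g + 1) x') ≤ V g x) ∧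
        ∃ a, V g x ≤ ∑ x', (M.P g x a x').toReal * (r g x a x' + V (g + 1) x') by
      obtain ⟨hs1, a, ha⟩ := hs
      refine le_antisymm (ha.trans ?_) (Finset.sup'_le _ _ fun a _ => hs1 a)
      exact Finset.le_sup' (fun a => ∑ x', (M.P g x a x').toReal * (r g x a x' + V (g + 1) x'))
        (Finset.mem_univ a)
    -- Before step `h` the Bellman equation is the recursion for `reachFrom`; at `h` it is the
    -- hypothesis on conditional means; afterwards everything is zero.
    rcases lt_trichotomy g h with hg | rfl | hg
    · have hg' : (g : ℕ) + 1 ≤ h := hg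
      have hQ : ∀ a, ∑ x', (M.P g x a x').toReal * (r g x a x' + V (g + 1) x')
          = κ * (expect (M.P g x a) (reachFrom M h s (h - (g + 1)))).toReal := fun a => by
        rw [toReal_expect _ (reachFrom_le_one M h s _), Finset.mul_sum]
        refine Finset.sum_congr rfl fun x' _ => ?_
        simp only [hV, hr0 g hg.ne, if_pos hg', Pi.zero_apply]
        ring
      have hVg : V g x = κ * (⨆ a, expect (M.P g x a) (reachFrom M h s (h - (g + 1)))).toReal := by
        simp only [hV, if_pos (Nat.le_of_succ_le hg'), reachFrom_sub M s hg]
      have hfin : (⨆ a, expect (M.P g x a) (reachFrom M h s (h - (g + 1)))) ≠ ∞ :=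
        ((iSup_le fun a => expect_le _ (reachFrom_le_one M h s _)).trans_lt
          ENNReal.one_lt_top).ne
      simp only [hQ, hVg]
      refine ⟨fun a => mul_le_mul_of_nonneg_left (ENNReal.toReal_mono hfin
        (le_iSup (fun a => expect (M.P g x a) _) a)) hκ.1, ?_⟩
      obtain ⟨a, ha⟩ := exists_eq_ciSup_of_finite
        (f := fun a => expect (M.P g x a) (reachFrom M h s (h - (g + 1))))
      exact ⟨a, by rw [← ha]⟩
    · have hVg : V g x = if x = s then κ else 0 := by
        simp only [hV, le_refl, if_true, Nat.sub_self, reachFrom]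
        split_ifs <;> simp
      have hVg' : ∀ x', V (g + 1) x' = 0 := fun x' => by simp [hV]
      simp only [hVg, hVg', add_zero]
      exact ⟨hle x, hex x⟩
    · have h1 : ¬ (g : ℕ) ≤ h := not_le.2 hg
      have h2 : ¬ (g : ℕ) + 1 ≤ h := fun h' => h1 (Nat.le_of_succ_le h')
      simp [hV, h1, h2, hr0 g hg.ne']
  · simp [hV, h.isLt]
  · by_cases hg : g = h
    · subst hg
      have : V (g + 1) x' = 0 := by simp [hV]
      rw [this, add_zero]
      exact hr x a x'
    · simpa [hr0 g hg] using hVI (g + 1) x'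
  · simp [hV, reachability, iSup_stateLaw]

theorem toReal_pmf_le_one (q : PMF S) (x : S) : (q x).toReal ≤ 1 := by
  simpa using ENNReal.toReal_mono ENNReal.one_ne_top (q.coe_le_one x)

theorem exists_isOptimalValue_stateReward [Fintype S] [Fintype A] [Nonempty A]
    (M : EpisodicMDP S A H) (h : Fin H) (s : S) :
    ∃ Q V, IsOptimalValue M (stateReward h s) Q V ∧ V 0 M.start = reachability M h s := by
  classical
  have hs : ∀ x a, ∑ x', (M.P h x a x').toReal * (stateReward h s h x a x')
      = if x = s then 1 else 0 := fun x a => by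
    simp only [stateReward, true_and, ← Finset.sum_mul, sum_toReal_pmf, one_mul]
  obtain ⟨Q, V, h1, h2⟩ := exists_isOptimalValue M h s (κ := 1) (r := stateReward h s)
    (by simp) (fun g hg => by funext x a x'; simp [stateReward, hg])
    (fun x a x' => by simp only [stateReward]; split_ifs <;> simp)
    (fun x a => (hs x a).le)
    (fun x => ⟨Classical.arbitrary A, (hs x _).ge⟩)
  exact ⟨Q, V, h1, by rw [h2, one_mul]⟩

theorem exists_isOptimalValue_transitionReward [Fintype S] [Fintype A] [Nonempty A]
    (M : EpisodicMDP S A H) (h : Fin H) (s : S) (a : A) (s' : S) :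
    ∃ Q V, IsOptimalValue M (transitionReward h s a s') Q V ∧
      V 0 M.start = (M.P h s a s').toReal * reachability M h s := by
  classical
  have hs : ∀ x y, ∑ x', (M.P h x y x').toReal * (transitionReward h s a s' h x y x')
      = if x = s ∧ y = a then (M.P h s a s').toReal else 0 := fun x y => by
    rw [Finset.sum_eq_single s' (fun x' _ hx' => by simp [transitionReward, hx']) (by simp)]
    simp only [transitionReward, true_and, and_true]
    split_ifs with hxy
    · rw [hxy.1, hxy.2, mul_one]
    · rw [mul_zero]
  refine exists_isOptimalValue M h s (κ := (M.P h s a s').toReal) (r := transitionReward h s a s')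
    ⟨ENNReal.toReal_nonneg, toReal_pmf_le_one _ _⟩
    (fun g hg => by funext x y x'; simp [transitionReward, hg])
    (fun x y x' => by simp only [transitionReward]; split_ifs <;> simp)
    (fun x y => ?_) (fun x => ⟨a, ?_⟩)
  · rw [hs]
    split_ifs with h1 h2 h2
    · exact le_rfl
    · exact absurd h1.1 h2
    · exact ENNReal.toReal_nonneg
    · exact le_rfl
  · rw [hs]; simp

end

section

/-! ### Numerical facts -/

theorem exists_episodeBound_le {C : ℝ} (hC : 0 < C) {nS nA H : ℕ} (hS : 1 ≤ nS) (hA : 1 ≤ nA)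
    (hH : 1 ≤ H) {p ε : ℝ} (hp : 0 < p) (hp1 : p < 1) (hε : 0 < ε) :
    ∃ K₀ : ℕ, 1 ≤ K₀ ∧ (K₀ : ℝ) ≤ 1 + episodeBound C nS nA H K₀ p ε ∧
      ∀ K : ℕ, K₀ ≤ K → episodeBound C nS nA H K p ε ≤ K := by
  classical
  have hS' : (1 : ℝ) ≤ nS := by exact_mod_cast hS
  have hA' : (1 : ℝ) ≤ nA := by exact_mod_cast hA
  have hH' : (1 : ℝ) ≤ H := by exact_mod_cast hH
  set a : ℝ := C * ((H : ℝ) ^ 5 * nS * nA / ε ^ 2) with ha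
  set m : ℝ := (nS : ℝ) * nA * H / p with hm
  have ha0 : 0 < a := by positivity
  have hm0 : 0 < m := by positivity
  have hm1 : 1 ≤ m := by
    rw [hm, le_div_iff₀ hp]
    have : (1 : ℝ) ≤ nS * nA * H := one_le_mul_of_one_le_of_one_le
      (one_le_mul_of_one_le_of_one_le hS' hA') hH'
    linarith
  have hb : ∀ K : ℕ, episodeBound C nS nA H K p ε = a * Real.log (m * K) := fun K => by
    rw [episodeBound, logFactor, ha, hm]
    rw [show (nS : ℝ) * nA * H * K / p = nS * nA * H / p * K by ring]; ring
  have hmono : ∀ K K' : ℕ, 1 ≤ K → K ≤ K' →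
      episodeBound C nS nA H K p ε ≤ episodeBound C nS nA H K' p ε := fun K K' h1 h2 => by
    have h1' : (1 : ℝ) ≤ K := by exact_mod_cast h1
    have h2' : (K : ℝ) ≤ K' := by exact_mod_cast h2
    rw [hb, hb]
    exact mul_le_mul_of_nonneg_left (Real.log_le_log (by positivity)
      (mul_le_mul_of_nonneg_left h2' hm0.le)) ha0.le
  have hnonneg : ∀ K : ℕ, 1 ≤ K → 0 ≤ episodeBound C nS nA H K p ε := fun K h1 => by
    have h1' : (1 : ℝ) ≤ K := by exact_mod_cast h1
    rw [hb]
    exact mul_nonneg ha0.le (Real.log_nonneg (one_le_mul_of_one_le_of_one_le hm1 h1'))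
  have hev : ∃ K₀ : ℕ, 1 ≤ K₀ ∧ ∀ K : ℕ, K₀ ≤ K → episodeBound C nS nA H K p ε ≤ K := by
    -- With bound `a * log (m * K)`, the part `a * log K` is eventually at most `K / 2`, and the
    -- constant `a * log m` is at most `K / 2` once `K ≥ 2 a log m`.
    have h1 := Real.isLittleO_log_id_atTop.bound (show (0 : ℝ) < 1 / (2 * a) by positivity)
    have h2 := (tendsto_natCast_atTop_atTop (R := ℝ)).eventually h1
    obtain ⟨K₁, hK₁⟩ := Filter.eventually_atTop.1 h2
    obtain ⟨K₂, hK₂⟩ := exists_nat_ge (2 * a * Real.log m)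
    refine ⟨max 1 (max K₁ K₂), le_max_left _ _, fun K hK => ?_⟩
    have hK1 : 1 ≤ K := (le_max_left _ _).trans hK
    have hK1' : (1 : ℝ) ≤ K := by exact_mod_cast hK1
    have h3 := hK₁ K ((le_max_left _ _).trans ((le_max_right _ _).trans hK))
    have h4 : (K₂ : ℝ) ≤ K := by
      exact_mod_cast (le_max_right _ _).trans ((le_max_right _ _).trans hK)
    rw [hb, Real.log_mul hm0.ne' (by positivity)]
    rw [id, Real.norm_of_nonneg (Real.log_nonneg hK1'), Real.norm_of_nonneg (by positivity)] at h3
    have h5 : a * Real.log K ≤ K / 2 := by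
      calc a * Real.log K ≤ a * (1 / (2 * a) * K) := by gcongr
        _ = K / 2 := by field_simp
    nlinarith
  refine ⟨Nat.find hev, (Nat.find_spec hev).1, ?_, (Nat.find_spec hev).2⟩
  have hK1 := (Nat.find_spec hev).1
  rcases hK1.eq_or_lt with h | h
  · rw [← h]; have := hnonneg 1 le_rfl; push_cast; linarith
  · obtain ⟨k, hk⟩ := Nat.exists_eq_add_of_lt h
    have hk' : Nat.find hev = (1 + k) + 1 := hk
    have hlt : 1 + k < Nat.find hev := by omega
    -- By minimality the predecessor of `K₀` must itself violate the condition, so `K₀ - 1` is below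
    -- its own bound and, by monotonicity, below that of `K₀`.
    have hnot := Nat.find_min hev hlt
    have : ((1 + k : ℕ) : ℝ) < episodeBound C nS nA H (1 + k) p ε := by
      by_contra hcon
      refine hnot ⟨by omega, fun K hK => ?_⟩
      rcases hK.eq_or_lt with rfl | hK'
      · exact not_lt.1 hcon
      · exact (Nat.find_spec hev).2 K (by omega)
    have h3 := hmono (1 + k) (Nat.find hev) (by omega) hlt.le
    have h4 : ((Nat.find hev : ℕ) : ℝ) = ((1 + k : ℕ) : ℝ) + 1 := by rw [hk']; push_cast; ring
    linarith

/-- The numerator `u - P v` lies in `[-P ε, ε]`: bound `v` by `d + ε` for the lower end and by `d`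
for the upper one. Then `P ≤ 1` and `v ≥ d` suffice. -/
theorem abs_div_sub_le {d P u v ε : ℝ} (hd : 0 < d) (hP : P ∈ Set.Icc (0 : ℝ) 1)
    (hu : P * d ≤ u) (hu' : u ≤ P * d + ε) (hv : d ≤ v) (hv' : v ≤ d + ε) :
    |u / v - P| ≤ ε / d := by
  have hv0 : 0 < v := hd.trans_le hv
  have hε : 0 ≤ ε := by linarith
  have h1 : u / v - P = (u - P * v) / v := by field_simp
  rw [h1, abs_div, abs_of_pos hv0]
  refine div_le_div₀ hε (abs_le.2 ⟨?_, ?_⟩) hd hv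
  · nlinarith [mul_le_mul_of_nonneg_left hv' hP.1, mul_le_mul_of_nonneg_right hP.2 hε]
  · nlinarith [mul_le_mul_of_nonneg_left hv hP.1]

theorem pseudo_sum_bound {Y h ι K β ε : ℝ} (hY : 1 ≤ Y) (hh : 1 ≤ h) (hι : 1 / 2 ≤ ι)
    (hK : 0 < K) (hε : 0 < ε) (hεh : ε ≤ h) (hβ : β ≤ 10 * Real.sqrt (h ^ 3 * ι))
    (hKb : 1000000 * (h ^ 5 * Y * ι / ε ^ 2) ≤ K) :
    3 * (Y * h ^ 2) + 12 * β * (h * Real.sqrt (Y * K)) ≤ ε * K := by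
  have h0 : 0 < h := by linarith
  have hY0 : 0 < Y := by linarith
  have hι0 : 0 < ι := by linarith
  have hKb' : 1000000 * (h ^ 5 * Y * ι) ≤ K * ε ^ 2 := by
    rw [← mul_div_assoc, div_le_iff₀ (by positivity)] at hKb; exact hKb
  -- The square of the left side is `h⁵ Y ι K`, at most `ε² K² / 10⁶` by the condition on `K`.
  have hsq : Real.sqrt (h ^ 3 * ι) * (h * Real.sqrt (Y * K)) ≤ ε * K / 1000 := by
    rw [mul_left_comm, ← Real.sqrt_mul (by positivity)]
    nth_rewrite 1 [← Real.sqrt_sq h0.le]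
    rw [← Real.sqrt_mul (by positivity)]
    refine Real.sqrt_le_iff.2 ⟨by positivity, ?_⟩
    nlinarith [mul_le_mul_of_nonneg_right hKb' hK.le]
  have h1 : 12 * β * (h * Real.sqrt (Y * K)) ≤ 120 * (ε * K / 1000) := by
    calc 12 * β * (h * Real.sqrt (Y * K))
        ≤ 12 * (10 * Real.sqrt (h ^ 3 * ι)) * (h * Real.sqrt (Y * K)) := by gcongr
      _ = 120 * (Real.sqrt (h ^ 3 * ι) * (h * Real.sqrt (Y * K))) := by ring
      _ ≤ _ := by gcongr
  have h2 : 500000 * (h ^ 2 * Y) ≤ K * ε := by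
    -- The lower-order term has no log factor and one power of `1 / ε` less, hence the use of `ι ≥ 1
    -- / 2` and `ε ≤ h`.
    have h3 : (500000 * (h ^ 2 * Y)) * h ≤ (K * ε) * h := by
      calc (500000 * (h ^ 2 * Y)) * h = 1000000 * (h ^ 3 * Y * (1 / 2)) := by ring
        _ ≤ 1000000 * (h ^ 5 * Y * ι) := by
          gcongr
          norm_num
        _ ≤ K * ε ^ 2 := hKb'
        _ = (K * ε) * ε := by ring
        _ ≤ _ := by gcongr
    exact le_of_mul_le_mul_right h3 h0
  nlinarith [mul_pos hε hK]

/-- Powers of `n = S A H K` absorb the constants `2` and `4` because `n ≥ 2`. The first bound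
controls `log N` by `3 ι`; the second counts the events of the union bound. -/
theorem two_le_pow_bound {nS nA H K : ℕ} (hA : 1 ≤ nA) (hH : 1 ≤ H) (hK : 1 ≤ K)
    (hn : 2 ≤ nS * nA * H * K) :
    2 * H * nS ^ 2 * nA ≤ (nS * nA * H * K) ^ 3 ∧
      4 * (H ^ 3 * nS ^ 3 * nA ^ 2 * K) ≤ (nS * nA * H * K) ^ 5 := by
  set n := nS * nA * H * K
  constructor
  · calc 2 * H * nS ^ 2 * nA = 2 * (nS ^ 2 * nA ^ 1 * H ^ 1 * 1) := by ring
      _ ≤ n * (nS ^ 2 * nA ^ 2 * H ^ 2 * K ^ 2) := by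
        gcongr <;> first | assumption | exact Nat.one_le_pow _ _ hK | norm_num
      _ = n ^ 3 := by simp only [n]; ring
  · calc 4 * (H ^ 3 * nS ^ 3 * nA ^ 2 * K) = 2 ^ 2 * (nS ^ 3 * nA ^ 2 * H ^ 3 * K ^ 1) := by ring
      _ ≤ n ^ 2 * (nS ^ 3 * nA ^ 3 * H ^ 3 * K ^ 3) := by
        gcongr <;> first | assumption | norm_num
      _ = n ^ 5 := by simp only [n]; ring

end

section

/-! ### The estimates -/

theorem one_half_le_logFactor {nS nA H K : ℕ} {p : ℝ} (hp : 0 < p) (hp1 : p < 1)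
    (hn : 2 ≤ nS * nA * H * K) : 1 / 2 ≤ logFactor nS nA H K p := by
  have h2 : (2 : ℝ) ≤ nS * nA * H * K := by exact_mod_cast hn
  have h3 : (2 : ℝ) ≤ nS * nA * H * K / p := by
    rw [le_div_iff₀ hp]; nlinarith
  unfold logFactor
  have := Real.log_le_log two_pos h3
  linarith [Real.log_two_gt_d9]

theorem log_le_logFactor {nS nA H K N : ℕ} {p : ℝ} (hp : 0 < p) (hp1 : p < 1) (hN : 1 ≤ N)
    (hn : 2 ≤ nS * nA * H * K) (hNn : N ≤ (nS * nA * H * K) ^ 3) :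
    Real.log N ≤ 3 * logFactor nS nA H K p := by
  have h2 : (2 : ℝ) ≤ nS * nA * H * K := by exact_mod_cast hn
  have h3 : (N : ℝ) ≤ (nS * nA * H * K) ^ 3 := by exact_mod_cast hNn
  have hN' : (1 : ℝ) ≤ N := by exact_mod_cast hN
  unfold logFactor
  calc Real.log N ≤ Real.log (((nS : ℝ) * nA * H * K) ^ 3) := Real.log_le_log (by linarith) h3
    _ = 3 * Real.log ((nS : ℝ) * nA * H * K) := by rw [Real.log_pow]; norm_num
    _ ≤ _ := by
      gcongr
      rw [le_div_iff₀ hp]; nlinarith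

theorem card_mul_exp_le {nS nA H K M : ℕ} {p : ℝ} (hp : 0 < p) (hp1 : p < 1)
    (hn : 2 ≤ nS * nA * H * K) (hM : M ≤ (nS * nA * H * K) ^ 5) :
    M * Real.exp (-(6 * logFactor nS nA H K p)) ≤ p := by
  have h2 : (2 : ℝ) ≤ nS * nA * H * K := by exact_mod_cast hn
  have h3 : (M : ℝ) ≤ (nS * nA * H * K) ^ 5 := by exact_mod_cast hM
  unfold logFactor
  set n : ℝ := (nS : ℝ) * nA * H * K
  have hn0 : 0 < n := by linarith
  have h4 : Real.exp (-(6 * Real.log (n / p))) = (p / n) ^ 6 := by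
    rw [show -(6 * Real.log (n / p)) = ((6 : ℕ) : ℝ) * Real.log (p / n) by
      rw [← inv_div n p, Real.log_inv]; push_cast; ring, Real.exp_nat_mul,
      Real.exp_log (by positivity)]
  rw [h4]
  calc (M : ℝ) * (p / n) ^ 6 ≤ n ^ 5 * (p / n) ^ 6 := by gcongr
    _ = p ^ 6 / n := by field_simp
    _ ≤ p := by
      rw [div_le_iff₀ hn0]
      have : p ^ 6 ≤ p ^ 1 := pow_le_pow_of_le_one hp.le hp1.le (by norm_num)
      nlinarith

variable {S A : Type*} {H : ℕ} [Fintype S] [Fintype A] [Nonempty A]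

/-- The averaged noise of all rewards of a finite family is bounded by the bonus with high
probability, if the bonus is large. -/
theorem toOuterMeasure_noise_le {I : Type*} [Fintype I] (M : EpisodicMDP S A H)
    (act : ActionRule S A H) (K : ℕ) {r : I → Fin H → S → A → S → ℝ} {Q : I → Fin H → S → A → ℝ}
    {V : I → ℕ → S → ℝ} (hQ : ∀ i, IsOptimalValue M (r i) (Q i) (V i)) {b : ℕ → ℝ}
    (hb0 : ∀ t, 1 ≤ t → 0 < b t) {x : ℝ} (hb : ∀ t : ℕ, 1 ≤ t → x ≤ b t ^ 2 * t / (4 * H))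
    {p : ℝ} (hp : ((Fintype.card I * Fintype.card (Fin H × S × A) * (K * H) * 2 : ℕ) : ℝ)
      * Real.exp (-x) ≤ p) :
    (explore M act K).toOuterMeasure {D | D ∈ (explore M act K).support ∧
        ¬ ∀ (i : I) (h : Fin H) (s : S) (a : A) (t : ℕ), 1 ≤ t → t ≤ K * H →
          |weightedSum (weight H t) (noise (r i) (Q i) (V i) h s a) (nexts h s a D.flatten)| ≤ b t}
      ≤ ENNReal.ofReal p := by
  -- One bad event per reward, table entry, visit number (shifted by one) and sign of the deviation.
  set sgn : Bool → ℝ := fun σ => if σ then 1 else -1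
  let bad : I × (Fin H × S × A) × Fin (K * H) × Bool → Set (List (List (Transition S A H))) :=
    fun j => {D | b (j.2.2.1 + 1) < sgn j.2.2.2 * weightedSum (weight H (j.2.2.1 + 1))
      (noise (r j.1) (Q j.1) (V j.1) j.2.1.1 j.2.1.2.1 j.2.1.2.2)
      (nexts j.2.1.1 j.2.1.2.1 j.2.1.2.2 D.flatten)}
  have hbad : ∀ j, (explore M act K).toOuterMeasure (bad j) ≤ ENNReal.ofReal (Real.exp (-x)) :=
    fun j => by
      refine (toOuterMeasure_weightedSum_le M act K j.2.1.1 j.2.1.2.1 j.2.1.2.2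
        ((hQ j.1).abs_noise_le _ _ _) ((hQ j.1).sum_noise _ _ _) (Nat.le_add_left 1 _)
        (hb0 _ (Nat.le_add_left 1 _)) ?_).trans ?_
      · simp only [sgn]; split_ifs <;> norm_num
      · gcongr
        exact hb _ (Nat.le_add_left 1 _)
  calc _ ≤ (explore M act K).toOuterMeasure (⋃ j, bad j) := by
        refine (explore M act K).toOuterMeasure.mono fun D hD => ?_
        obtain ⟨-, hD⟩ := hD
        push Not at hD
        obtain ⟨i, h, s, a, t, ht, htK, hlt⟩ := hD
        obtain ⟨t, rfl⟩ := Nat.exists_eq_add_of_le' ht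
        rcases lt_abs.1 hlt with h1 | h1
        · exact Set.mem_iUnion.2 ⟨(i, (h, s, a), ⟨t, htK⟩, true), by
            simpa [bad, sgn] using h1⟩
        · exact Set.mem_iUnion.2 ⟨(i, (h, s, a), ⟨t, htK⟩, false), by
            simpa [bad, sgn] using h1⟩
    _ ≤ ∑ j, (explore M act K).toOuterMeasure (bad j) :=
        MeasureTheory.measure_iUnion_fintype_le _ _
    _ ≤ ∑ _j : I × (Fin H × S × A) × Fin (K * H) × Bool, ENNReal.ofReal (Real.exp (-x)) :=
        Finset.sum_le_sum fun j _ => hbad j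
    _ ≤ ENNReal.ofReal p := by
        rw [Finset.sum_const, Finset.card_univ, nsmul_eq_mul, ← ENNReal.ofReal_natCast,
          ← ENNReal.ofReal_mul (Nat.cast_nonneg _)]
        refine ENNReal.ofReal_le_ofReal (le_trans (le_of_eq ?_) hp)
        congr 2
        rw [Fintype.card_prod, Fintype.card_prod (Fin H × S × A), Fintype.card_prod (Fin (K * H)),
          Fintype.card_fin, Fintype.card_bool]
        ring

/-- On the event that the averaged noise is small, the average optimistic value overestimates
the optimal value by at most the average pseudo-value. -/
theorem averageValue_mem {M : EpisodicMDP S A H} {r : Fin H → S → A → S → ℝ}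
    {Q : Fin H → S → A → ℝ} {V : ℕ → S → ℝ} (hQ : IsOptimalValue M r Q V) (hH : 0 < H)
    {b : ℕ → ℝ} (hmono : ∀ t, 1 ≤ t → b (t + 1) ≤ b t) {K : ℕ} (hK : 1 ≤ K)
    {D : List (List (Transition S A H))}
    (hW : ∀ h s a t, 1 ≤ t → t ≤ D.flatten.length →
      |weightedSum (weight H t) (noise r Q V h s a) (nexts h s a D.flatten)| ≤ b t) {ε : ℝ}
    (hε : ∑ k ∈ Finset.range K, (pseudoTables b (D.take k).flatten).valueAt 0 M.start ≤ ε * K) :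
    V 0 M.start ≤ averageValue b K D r hH M.start ∧
      averageValue b K D r hH M.start ≤ V 0 M.start + ε := by
  have hK' : (0 : ℝ) < K := by exact_mod_cast hK
  have hpre : ∀ k, (D.take k).flatten <+: D.flatten := fun k => by
    conv_rhs => rw [← List.take_append_drop k D, List.flatten_append]
    exact List.prefix_append _ _
  have hWp : ∀ L', L' <+: D.flatten → ∀ h s a,
      |recAverage H (noise r Q V h s a) (nexts h s a L')| ≤
        avgBonus H b (nexts h s a L').length := fun L' hL' h s a => by
    rcases Nat.eq_zero_or_pos (nexts h s a L').length with h0 | h0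
    · rw [List.length_eq_zero_iff.1 h0]; simp [recAverage, avgBonus]
    · exact (abs_recAverage_le (hW h s a) hL' h0).trans (le_avgBonus hmono h0)
  have hval : ∀ k, V 0 M.start ≤ (learn b r (D.take k).flatten).valueAt 0 M.start ∧
      (learn b r (D.take k).flatten).valueAt 0 M.start ≤
        V 0 M.start + (pseudoTables b (D.take k).flatten).valueAt 0 M.start := fun k =>
    hQ.valueAt_learn_mem (fun L' hL' => hWp L' (hL'.trans (hpre k))) (Nat.zero_le _) _
  have havg : averageValue b K D r hH M.start =
      (∑ k ∈ Finset.range K, (learn b r (D.take k).flatten).valueAt 0 M.start) / K := by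
    simp only [averageValue, Tables.valueAt, dif_pos hH]
  have hconst : ∑ _k ∈ Finset.range K, V 0 M.start = V 0 M.start * K := by
    simp [mul_comm]
  rw [havg, le_div_iff₀ hK', div_le_iff₀ hK', add_mul, ← hconst]
  refine ⟨Finset.sum_le_sum fun k _ => (hval k).1, ?_⟩
  calc _ ≤ ∑ k ∈ Finset.range K, (V 0 M.start
        + (pseudoTables b (D.take k).flatten).valueAt 0 M.start) :=
        Finset.sum_le_sum fun k _ => (hval k).2
    _ ≤ _ := by rw [Finset.sum_add_distrib]; linarith

/-- With one state, one action, one step and one episode, the estimate is exact. -/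
theorem modelEstimate_trivial {M : EpisodicMDP S A H} {K : ℕ}
    (hn : Fintype.card S * Fintype.card A * H * K = 1) (b : ℕ → ℝ)
    (D : List (List (Transition S A H))) (h : Fin H) (s : S) (a : A) (s' : S) :
    modelEstimate b K D M.start h s a s' - (M.P h s a s').toReal = 0 := by
  obtain ⟨h1, rfl⟩ := mul_eq_one.1 hn
  obtain ⟨h2, rfl⟩ := mul_eq_one.1 h1
  obtain ⟨h3, -⟩ := mul_eq_one.1 h2
  have : Subsingleton S := (Fintype.card_le_one_iff_subsingleton).1 h3.le
  have hP := sum_toReal_pmf (M.P h s a)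
  rw [Fintype.sum_subsingleton _ s'] at hP
  rw [hP]
  have : ∀ r : Fin 1 → S → A → S → ℝ, averageValue b 1 D r h.pos M.start = 1 := fun r => by
    simp [averageValue, learn, Tables.value, Tables.init]
  rw [modelEstimate, this, this]; norm_num

theorem bonus_eq {c : ℝ} {nS nA H K N : ℕ} {p : ℝ}
    (h : 0 ≤ Real.log N + logFactor nS nA H K p) (t : ℕ) :
    bonus c nS nA H K N p t =
      c * Real.sqrt ((H : ℝ) ^ 3 * (Real.log N + logFactor nS nA H K p)) / Real.sqrt t := by
  rw [bonus, Real.sqrt_div (by positivity), mul_div_assoc]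

theorem ofReal_one_sub_le_toOuterMeasure {α : Type*} (q : PMF α) {p : ℝ} (hp : 0 ≤ p)
    {s B : Set α} (hB : q.toOuterMeasure B ≤ ENNReal.ofReal p)
    (hs : ∀ x ∈ q.support, x ∉ B → x ∈ s) : ENNReal.ofReal (1 - p) ≤ q.toOuterMeasure s := by
  rw [ENNReal.ofReal_sub _ hp, ENNReal.ofReal_one, tsub_le_iff_right]
  have h1 : q.toOuterMeasure (s ∪ B) = 1 :=
    (q.toOuterMeasure_apply_eq_one_iff _).2 fun x hx => by
      by_cases hxB : x ∈ B
      · exact Or.inr hxB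
      · exact Or.inl (hs x hx hxB)
  rw [← h1]
  exact (MeasureTheory.measure_union_le s B).trans (add_le_add_right hB _)

theorem modelEstimate_bound (hH : 0 < H) (M : EpisodicMDP S A H) {p ε : ℝ} (hp : 0 < p)
    (hp1 : p < 1) (hε : 0 < ε) {N : ℕ} (hN : 1 ≤ N)
    (hNle : N ≤ 2 * H * Fintype.card S ^ 2 * Fintype.card A) {K : ℕ} (hK : 1 ≤ K)
    (hKb : episodeBound 1000000 (Fintype.card S) (Fintype.card A) H K p ε ≤ K) {b : ℕ → ℝ}
    (hb : b = bonus 5 (Fintype.card S) (Fintype.card A) H K N p) {act : ActionRule S A H}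
    (hact : IsGreedy b act) :
    ENNReal.ofReal (1 - p) ≤ (explore M act K).toOuterMeasure
      {D | ∀ (h : Fin H) (s : S) (a : A) (s' : S), 0 < reachability M h s →
        |modelEstimate b K D M.start h s a s' - (M.P h s a s').toReal| ≤
          ε / reachability M h s} := by
  classical
  have hS1 : 1 ≤ Fintype.card S := Fintype.card_pos_iff.2 ⟨M.start⟩
  have hA1 : 1 ≤ Fintype.card A := Fintype.card_pos
  set n := Fintype.card S * Fintype.card A * H * K with hn
  have hn1 : 1 ≤ n := Nat.mul_pos (Nat.mul_pos (Nat.mul_pos hS1 hA1) hH) hK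
  -- When `S A H K = 1` the factor `ι` can be arbitrarily close to `0` and need not control `log N`,
  -- but then the estimate is exact.
  rcases hn1.eq_or_lt with hn1 | hn2
  · refine ofReal_one_sub_le_toOuterMeasure _ hp.le (B := ∅) (by simp) fun D _ _ => ?_
    intro h s a s' hd
    rw [modelEstimate_trivial hn1.symm, abs_zero]
    positivity
  obtain ⟨hpow1, hpow2⟩ := two_le_pow_bound hA1 hH hK hn2
  have hι := one_half_le_logFactor hp hp1 hn2
  have hlogN := log_le_logFactor hp hp1 hN hn2 (hNle.trans hpow1)
  set ι := logFactor (Fintype.card S) (Fintype.card A) H K p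
  have hlog0 : 0 ≤ Real.log N := Real.log_natCast_nonneg N
  have hH' : (1 : ℝ) ≤ H := by exact_mod_cast hH
  set β := 5 * Real.sqrt ((H : ℝ) ^ 3 * (Real.log N + ι)) with hβ
  have hβ0 : 0 < β := by positivity
  have hbβ : ∀ t : ℕ, b t = β / Real.sqrt t := fun t => by
    rw [hb]; exact bonus_eq (by positivity) t
  have hb0 : ∀ t, 1 ≤ t → 0 < b t := fun t ht => by
    have : (0 : ℝ) < t := by exact_mod_cast ht
    rw [hbβ]; positivity
  have hmono : ∀ t, 1 ≤ t → b (t + 1) ≤ b t := fun t ht => by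
    have : (0 : ℝ) < t := by exact_mod_cast ht
    rw [hbβ, hbβ]
    gcongr
    linarith
  -- The bonus constant `5` yields `25 / 4 ≥ 6`; the exponent `6 ι` beats the fifth power of `n` in
  -- the union bound.
  have hbx : ∀ t : ℕ, 1 ≤ t → 6 * ι ≤ b t ^ 2 * t / (4 * H) := fun t ht => by
    have ht' : (0 : ℝ) < t := by exact_mod_cast ht
    have h1 : b t ^ 2 * t = 25 * ((H : ℝ) ^ 3 * (Real.log N + ι)) := by
      rw [hbβ, div_pow, Real.sq_sqrt ht'.le, div_mul_cancel₀ _ ht'.ne', hβ, mul_pow,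
        Real.sq_sqrt (by positivity)]
      norm_num
    rw [h1, le_div_iff₀ (by positivity)]
    have h2 : (H : ℝ) ≤ (H : ℝ) ^ 3 := le_self_pow₀ hH' (by norm_num)
    have h3 : (H : ℝ) * ι ≤ (H : ℝ) ^ 3 * (Real.log N + ι) := by gcongr; linarith
    have h4 : 0 ≤ (H : ℝ) * ι := by positivity
    linarith
  have hβ' : β ≤ 10 * Real.sqrt ((H : ℝ) ^ 3 * ι) := by
    calc β ≤ 5 * Real.sqrt (2 ^ 2 * ((H : ℝ) ^ 3 * ι)) := by
          have : (H : ℝ) ^ 3 * (Real.log N + ι) ≤ (H : ℝ) ^ 3 * (3 * ι + ι) := by gcongr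
          exact mul_le_mul_of_nonneg_left (Real.sqrt_le_sqrt (by linarith)) (by norm_num)
      _ = _ := by rw [Real.sqrt_mul (by norm_num), Real.sqrt_sq (by norm_num)]; ring
  let r : Bool × Fin H × S × A × S → Fin H → S → A → S → ℝ := fun i =>
    if i.1 then transitionReward i.2.1 i.2.2.1 i.2.2.2.1 i.2.2.2.2
    else stateReward i.2.1 i.2.2.1
  have hex : ∀ i, ∃ Q V, IsOptimalValue M (r i) Q V ∧ V 0 M.start =
      (if i.1 then (M.P i.2.1 i.2.2.1 i.2.2.2.1 i.2.2.2.2).toReal else 1)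
        * reachability M i.2.1 i.2.2.1 := by
    rintro ⟨_ | _, h, s, a, s'⟩
    · simpa [r] using exists_isOptimalValue_stateReward M h s
    · simpa [r] using exists_isOptimalValue_transitionReward M h s a s'
  choose Q V hQ hV using hex
  refine ofReal_one_sub_le_toOuterMeasure _ hp.le
    (toOuterMeasure_noise_le M act K hQ hb0 hbx (card_mul_exp_le hp hp1 hn2
      (le_trans (le_of_eq ?_) hpow2))) fun D hD hDB => ?_
  · simp only [Fintype.card_prod, Fintype.card_bool, Fintype.card_fin]
    ring
  have hgood : ∀ (i : Bool × Fin H × S × A × S) (h : Fin H) (s : S) (a : A) (t : ℕ), 1 ≤ t →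
      t ≤ K * H → |weightedSum (weight H t) (noise (r i) (Q i) (V i) h s a)
        (nexts h s a D.flatten)| ≤ b t := by
    by_contra hcon
    exact hDB ⟨hD, hcon⟩
  have hlen := (explore_potential_le hβ0.le hbβ hact hD).2.1
  have hsum : ∑ k ∈ Finset.range K, (pseudoTables b (D.take k).flatten).valueAt 0 M.start
      ≤ ε * K := by
    -- For `ε ≥ H` the truncation of the values at `H` is already enough.
    rcases le_total ε H with hεH | hεH
    · refine (sum_valueAt_pseudoTables_le hβ0.le hbβ hact hD).trans ?_
      refine pseudo_sum_bound (ι := ι) ?_ hH' hι (by exact_mod_cast hK) hε hεH hβ' ?_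
      · exact_mod_cast Nat.mul_pos hS1 hA1
      · refine le_trans (le_of_eq ?_) hKb
        rw [episodeBound]; ring
    · calc _ ≤ ∑ _k ∈ Finset.range K, (H : ℝ) :=
            Finset.sum_le_sum fun k _ => Tables.valueAt_le _ _ _
        _ ≤ ε * K := by
            rw [Finset.sum_const, Finset.card_range, nsmul_eq_mul, mul_comm]
            gcongr
  -- One good event and one bound on the pseudo-values serve the numerator and denominator of every
  -- estimate.
  have hmem := fun i => averageValue_mem (hQ i) hH hmono hK
    (fun h s a t ht htK => hgood i h s a t ht (hlen ▸ htK)) hsum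
  intro h s a s' hd
  have h1 := hmem (true, h, s, a, s')
  have h2 := hmem (false, h, s, a, s')
  rw [hV] at h1 h2
  simp only [r, if_true, Bool.false_eq_true, if_false, one_mul] at h1 h2
  exact abs_div_sub_le hd ⟨ENNReal.toReal_nonneg, toReal_pmf_le_one _ _⟩ h1.1 h1.2 h2.1 h2.2

end

end UCBZero

end

theorem theorem3 :
    ∃ c : ℝ, 0 < c ∧ ∃ C : ℝ, 0 < C ∧
      ∀ (S A : Type*) [Fintype S] [Fintype A] [Nonempty A] (H : ℕ), 0 < H →
      ∀ (M : UCBZero.EpisodicMDP S A H) (p ε : ℝ), 0 < p → p < 1 → 0 < ε →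
        (∃ K₀ : ℕ, 1 ≤ K₀ ∧
          (K₀ : ℝ) ≤ 1 + UCBZero.episodeBound C (Fintype.card S) (Fintype.card A) H K₀ p ε ∧
          ∀ K : ℕ, K₀ ≤ K →
            UCBZero.episodeBound C (Fintype.card S) (Fintype.card A) H K p ε ≤ (K : ℝ)) ∧
        ∀ (N : ℕ), 1 ≤ N → N ≤ 2 * H * Fintype.card S ^ 2 * Fintype.card A →
        ∀ (K : ℕ), 1 ≤ K →
          UCBZero.episodeBound C (Fintype.card S) (Fintype.card A) H K p ε ≤ (K : ℝ) →
        ∀ b : ℕ → ℝ, b = UCBZero.bonus c (Fintype.card S) (Fintype.card A) H K N p →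
        ∀ act : UCBZero.ActionRule S A H, UCBZero.IsGreedy b act →
          ENNReal.ofReal (1 - p) ≤
            (UCBZero.explore M act K).toOuterMeasure
              {D | ∀ (h : Fin H) (s : S) (a : A) (s' : S), 0 < UCBZero.reachability M h s →
                |UCBZero.modelEstimate b K D M.start h s a s' - (M.P h s a s').toReal| ≤
                  ε / UCBZero.reachability M h s} := by
  refine ⟨5, by norm_num, 1000000, by norm_num, ?_⟩
  intro S A _ _ _ H hH M p ε hp hp1 hε
  refine ⟨UCBZero.exists_episodeBound_le (by norm_num) (Fintype.card_pos_iff.2 ⟨M.start⟩)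
    Fintype.card_pos hH hp hp1 hε, ?_⟩
  intro N hN hNle K hK hKb b hb act hact
  exact UCBZero.modelEstimate_bound hH M hp hp1 hε hN hNle hK hKb hb hact
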